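/- Let $\mathbf u=2^{-53}$, let $m\ge n\ge 1$, and let $X\in\mathbb R^{m\times n}$ (sparse or not) have rank $n$, with columns $X_1,\dots,X_n$ and singular values $\|X\|_2=\sigma_1(X)\ge\dots\ge\sigma_n(X)>0$. Put $\kappa_2(X)=\|X\|_2/\sigma_n(X)$, $\|X\|_g=\sqrt n\,\max_{1\le k\le n}\|X_k\|_2$ and $j=\|X\|_g/\|X\|_2$. Assume $$mn\mathbf u\le \tfrac1{64},\qquad n(n+1)\mathbf u\le\tfrac1{64},\qquad \kappa_2(X)\le K_2:=\frac{1}{10.5\,j\,\sqrt{m\mathbf u+(n+1)\mathbf u}} .$$ The algorithm CholeskyQR2 computes $[W,Y]=\mathrm{CholeskyQR}(X)$, $[Q,Z]=\mathrm{CholeskyQR}(W)$ and $R=ZY$, where $[V,T]=\mathrm{CholeskyQR}(A)$ stands for: $G=A^\top A$; $T$ is the upper triangular Cholesky factor of $G$ ($T^\top T=G$); $V=AT^{-1}$, obtained by solving $VT=A$ row by row by substitution. It is executed in floating-point arithmetic under the standard model: every operation $+,-,\times,/,\sqrt{\ }$ with exact result $x$ returns a number $x(1+\delta)$ with $|\delta|\le\mathbf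 u$ (no over- or underflow), and sums are evaluated in any order. Then neither of the two Cholesky factorizations breaks down (all pivots are positive), and whatever the rounding errors, the computed $Q$ and $R$ satisfy $$\|Q^\top Q-I_n\|_F\le 5.9\,\bigl(mn\mathbf u+n(n+1)\mathbf u\bigr),\qquad \|QR-X\|_F\le U_6:=\bigl(2.52\,j+1.34\sqrt n\bigr)\,n\sqrt n\,\mathbf u\,\|X\|_2 .$$ Moreover $U_6<5n^2\sqrt n\,\mathbf u\,\|X\|_2$, that is, $U_6$ is smaller than the residual bound of Yamamoto et al. for CholeskyQR2. -/

import Mathlib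

/-!
Rounding-error model and CholeskyQR2.

Floating-point arithmetic is the standard model: every elementary operation (addition,
subtraction, multiplication, division, square root) returns some real number whose relative
distance from the exact value is at most the unit roundoff; over- and underflow are disregarded.
Nothing else is required of the returned number, so that different operations may round
differently, and sums may be evaluated in any order. Each algorithm is described by the relation
between its input and everything that it can compute under this model.
-/

namespace FlQR

noncomputable section

/-- Unit roundoff (machine precision) of IEEE double precision, `u = 2⁻⁵³`. -/
def unitRoundoff : ℝ := (2 : ℝ)⁻¹ ^ 53

/-- `IsRounding x y`: the number `y` may be returned by an elementary floating-point operation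
whose exact result is `x`, that is `y = x (1 + δ)` with `|δ| ≤ u`. -/
def IsRounding (x y : ℝ) : Prop := |y - x| ≤ unitRoundoff * |x|

/-- `IsFlSum s a`: the number `a` may be obtained by adding up the (finitely many, at least one)
numbers in `s` in floating-point arithmetic, in some order and with some placement of the
parentheses. -/
inductive IsFlSum : Multiset ℝ → ℝ → Prop
  | single (x : ℝ) : IsFlSum {x} x
  | add {s t : Multiset ℝ} {a b c : ℝ} (hs : IsFlSum s a) (ht : IsFlSum t b)
      (hc : IsRounding (a + b) c) : IsFlSum (s + t) c

/-- `IsFlMul A B C`: `C` may be the computed value `fl(A B)` of the matrix product `A B`; every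
entry is a sum of rounded products, evaluated in any order. -/
def IsFlMul {m k n : ℕ} (A : Matrix (Fin m) (Fin k) ℝ) (B : Matrix (Fin k) (Fin n) ℝ)
    (C : Matrix (Fin m) (Fin n) ℝ) : Prop :=
  ∀ i j, ∃ p : Fin k → ℝ, (∀ l, IsRounding (A i l * B l j) (p l)) ∧
    IsFlSum (Finset.univ.val.map p) (C i j)

/-- `IsFlSubDot c K a b t`: `t` may be the computed value of `c - ∑ l ∈ K, a l * b l`. -/
def IsFlSubDot {n : ℕ} (c : ℝ) (K : Finset (Fin n)) (a b : Fin n → ℝ) (t : ℝ) : Prop :=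
  ∃ p : Fin n → ℝ, (∀ l ∈ K, IsRounding (a l * b l) (p l)) ∧
    IsFlSum (c ::ₘ K.val.map (fun l => -p l)) t

/-- `IsFlCholesky G s R`: `R` is an upper triangular factor and `s` the sequence of pivots that the
Cholesky factorization of the symmetric matrix given by the upper triangle of `G` may compute:
`s j = fl(G j j - ∑ l < j, (R l j)²)`, `R j j = fl(√(s j))` and
`R i j = fl((G i j - ∑ l < i, R l i * R l j) / R i i)` for `i < j`.

The factorization breaks down at the first `j` with `s j ≤ 0`; it runs to completion if and only if
all pivots are positive. (After a breakdown the relation goes on with the conventions `√x = 0` for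
`x ≤ 0` and `x / 0 = 0`, so that a breakdown is visible in `s` and does not remove the execution.) -/
structure IsFlCholesky {n : ℕ} (G : Matrix (Fin n) (Fin n) ℝ) (s : Fin n → ℝ)
    (R : Matrix (Fin n) (Fin n) ℝ) : Prop where
  lower : ∀ i j, j < i → R i j = 0
  pivot : ∀ j, IsFlSubDot (G j j) (Finset.Iio j) (fun l => R l j) (fun l => R l j) (s j)
  diag : ∀ j, IsRounding (√(s j)) (R j j)
  upper : ∀ i j, i < j → ∃ t,
    IsFlSubDot (G i j) (Finset.Iio i) (fun l => R l i) (fun l => R l j) t ∧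
      IsRounding (t / R i i) (R i j)

/-- `IsFlTriSolve X R Q`: `Q` may be the computed value of `X R⁻¹` for an upper triangular `R`,
obtained by solving `Q R = X` row by row by substitution:
`Q i j = fl((X i j - ∑ l < j, Q i l * R l j) / R j j)`. -/
def IsFlTriSolve {m n : ℕ} (X : Matrix (Fin m) (Fin n) ℝ) (R : Matrix (Fin n) (Fin n) ℝ)
    (Q : Matrix (Fin m) (Fin n) ℝ) : Prop :=
  ∀ i j, ∃ t, IsFlSubDot (X i j) (Finset.Iio j) (fun l => Q i l) (fun l => R l j) t ∧
    IsRounding (t / R j j) (Q i j)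

/-- `IsFlCholeskyQR X s Q R`: a floating-point execution of `[Q, R] = CholeskyQR(X)`
(`G = Xᵀ X`, `R = Cholesky(G)`, `Q = X R⁻¹`) may produce `Q` and `R`, with pivots `s` in the
Cholesky factorization. -/
def IsFlCholeskyQR {m n : ℕ} (X : Matrix (Fin m) (Fin n) ℝ) (s : Fin n → ℝ)
    (Q : Matrix (Fin m) (Fin n) ℝ) (R : Matrix (Fin n) (Fin n) ℝ) : Prop :=
  ∃ G : Matrix (Fin n) (Fin n) ℝ,
    IsFlMul X.transpose X G ∧ IsFlCholesky G s R ∧ IsFlTriSolve X R Q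

/-- `IsFlCholeskyQR2 X s₁ s₂ Q R`: a floating-point execution of `[Q, R] = CholeskyQR2(X)`
(`[W, Y] = CholeskyQR(X)`, `[Q, Z] = CholeskyQR(W)`, `R = Z Y`) may produce `Q` and `R`, with
pivots `s₁` and `s₂` in its two Cholesky factorizations. -/
def IsFlCholeskyQR2 {m n : ℕ} (X : Matrix (Fin m) (Fin n) ℝ) (s₁ s₂ : Fin n → ℝ)
    (Q : Matrix (Fin m) (Fin n) ℝ) (R : Matrix (Fin n) (Fin n) ℝ) : Prop :=
  ∃ (W : Matrix (Fin m) (Fin n) ℝ) (Y Z : Matrix (Fin n) (Fin n) ℝ),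
    IsFlCholeskyQR X s₁ W Y ∧ IsFlCholeskyQR W s₂ Q Z ∧ IsFlMul Z Y R

/-- The Frobenius norm `‖A‖_F`. -/
def normF {m n : ℕ} (A : Matrix (Fin m) (Fin n) ℝ) : ℝ :=
  @norm _ Matrix.frobeniusNormedAddCommGroup.toNorm A

/-- The spectral norm `‖A‖₂`. -/
def norm2 {m n : ℕ} (A : Matrix (Fin m) (Fin n) ℝ) : ℝ :=
  @norm _ Matrix.instL2OpNormedAddCommGroup.toNorm A

/-- The norm `‖A‖_g`: `√n` times the largest Euclidean norm of one of the `n` columns. -/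
def normG {m n : ℕ} (A : Matrix (Fin m) (Fin n) ℝ) : ℝ :=
  √(n : ℝ) * ⨆ j : Fin n, ‖WithLp.toLp 2 (fun i => A i j)‖

/-- The `n`-th greatest singular value of an `m × n` matrix (Mathlib counts from zero). -/
def sigmaMin {m n : ℕ} (A : Matrix (Fin m) (Fin n) ℝ) : ℝ :=
  (Matrix.toEuclideanLin A).singularValues (n - 1)

/-- The condition number `κ₂(A) = ‖A‖₂ / σₙ(A)` (used for matrices of rank `n`). -/
def cond2 {m n : ℕ} (A : Matrix (Fin m) (Fin n) ℝ) : ℝ := norm2 A / sigmaMin A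

/-- The ratio `j = ‖A‖_g / ‖A‖₂`. -/
def ratioJ {m n : ℕ} (A : Matrix (Fin m) (Fin n) ℝ) : ℝ := normG A / norm2 A

/-- The bound `K₂ = 1 / (10.5 j √(m u + (n+1) u))` for the condition number. -/
def boundK2 {m n : ℕ} (X : Matrix (Fin m) (Fin n) ℝ) : ℝ :=
  1 / (10.5 * ratioJ X * √((m : ℝ) * unitRoundoff + ((n : ℝ) + 1) * unitRoundoff))

/-- The residual bound `U₆ = (2.52 j + 1.34 √n) n √n u ‖X‖₂`. -/
def boundU6 {m n : ℕ} (X : Matrix (Fin m) (Fin n) ℝ) : ℝ :=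
  (2.52 * ratioJ X + 1.34 * √(n : ℝ)) * ((n : ℝ) * √(n : ℝ)) * unitRoundoff * norm2 X

end

end FlQR

/-! Write ε = mu + (n+1)u. If ‖A‖_F ≤ f and ‖Av‖ ≥ σ‖v‖, the computed Cholesky factor T of the
computed Gram matrix satisfies TᵀT = AᵀA + E with ‖E‖_F ≤ 1.05 ε f². As soon as this is at most ησ²
with η small, TᵀT and AᵀA agree as quadratic forms up to the relative error η, so that S = T⁻¹ has
norm about 1/σ and AS is almost orthonormal. Substitution gives VT = A + D with small D, hence V =
AS + DS, and VᵀV - I consists of -SᵀES and terms containing DS. This is `IsFlCholeskyQR.step`.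

It is used twice. For X the condition number bound makes η less than 0.01, so W is only roughly
orthonormal (error 0.028), but well conditioned. For W one has σ near 1 and f near √n, so η is a
multiple of nε and the orthogonality error falls to rounding level. The residual bound follows from
QR - X = Q(R - ZY) + (QZ - W)Y + (WY - X).

The delicate point is the absence of breakdown (`pivot_pos`). At a first nonpositive pivot k, the k
rows of R computed so far annihilate some v ≠ 0 supported on the indices up to k. These rows
reproduce AᵀA up to rounding on that block, except at the corner (k,k), where the bad pivot supplies
an inequality. Hence ‖Av‖² is of rounding size, against the lower bound for A. -/

namespace FlQR

noncomputable section

/-! ### Accumulated relative rounding errors -/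

/-- The bound `(1 - u)⁻ᵏ - 1` for the relative effect of `k` successive roundings. -/
def accErr (k : ℕ) : ℝ := ((1 - unitRoundoff) ^ k)⁻¹ - 1

lemma unitRoundoff_pos : 0 < unitRoundoff := by unfold unitRoundoff; positivity

lemma unitRoundoff_lt : unitRoundoff < 1 / 1000 := by unfold unitRoundoff; norm_num

/-- The choice of (1 - u)⁻ᵏ makes error factors compose exactly and bounds a rounding in both
directions, exact by computed and computed by exact. -/
lemma one_add_accErr_add (k l : ℕ) :
    1 + accErr (k + l) = (1 + accErr k) * (1 + accErr l) := by
  simp only [accErr, add_sub_cancel, pow_add, mul_inv]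

lemma accErr_nonneg (k : ℕ) : 0 ≤ accErr k := by
  have h := unitRoundoff_lt
  have h' := unitRoundoff_pos
  have : (1 - unitRoundoff) ^ k ≤ 1 := pow_le_one₀ (by linarith) (by linarith)
  have h2 : 0 < (1 - unitRoundoff) ^ k := pow_pos (by linarith) _
  have := (one_le_inv₀ h2).2 this
  unfold accErr; linarith

lemma accErr_mono {k l : ℕ} (h : k ≤ l) : accErr k ≤ accErr l := by
  obtain ⟨d, rfl⟩ := Nat.exists_eq_add_of_le h
  have := one_add_accErr_add k d
  have := mul_nonneg (by linarith [accErr_nonneg k] : 0 ≤ 1 + accErr k) (accErr_nonneg d)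
  nlinarith

lemma one_add_accErr_one_mul : (1 + accErr 1) * (1 - unitRoundoff) = 1 := by
  have h := unitRoundoff_lt
  simp only [accErr, pow_one, add_sub_cancel]
  exact inv_mul_cancel₀ (by linarith)

lemma unitRoundoff_le_accErr_one : unitRoundoff ≤ accErr 1 := by
  have h := unitRoundoff_lt
  have h1 := one_add_accErr_one_mul
  have h2 := accErr_nonneg 1
  nlinarith [unitRoundoff_pos]

lemma accErr_le {k : ℕ} (h : (k : ℝ) * unitRoundoff ≤ 1 / 110) :
    accErr k ≤ 1.01 * ((k : ℝ) * unitRoundoff) := by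
  have hu := unitRoundoff_lt
  have hb : 1 + (k : ℝ) * (-unitRoundoff) ≤ (1 + -unitRoundoff) ^ k :=
    one_add_mul_le_pow (by linarith) k
  have hk : 0 ≤ (k : ℝ) * unitRoundoff := mul_nonneg (Nat.cast_nonneg _) unitRoundoff_pos.le
  have hp : 0 < 1 - (k : ℝ) * unitRoundoff := by linarith
  have : ((1 - unitRoundoff) ^ k)⁻¹ ≤ (1 - (k : ℝ) * unitRoundoff)⁻¹ := by
    apply inv_anti₀ hp
    rw [sub_eq_add_neg 1 unitRoundoff]; linarith
  have h2 : (1 - (k : ℝ) * unitRoundoff)⁻¹ ≤ 1 + 1.01 * ((k : ℝ) * unitRoundoff) := by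
    rw [inv_le_iff_one_le_mul₀ hp]; nlinarith
  unfold accErr; linarith

namespace IsRounding

lemma abs_exact_le {x y : ℝ} (h : IsRounding x y) : |x| ≤ (1 + accErr 1) * |y| := by
  have h1 : |x| * (1 - unitRoundoff) ≤ |y| := by
    have := abs_sub_abs_le_abs_sub x y
    unfold IsRounding at h
    rw [abs_sub_comm] at h
    linarith
  calc |x| = (1 + accErr 1) * (|x| * (1 - unitRoundoff)) := by
        rw [mul_comm |x|, ← mul_assoc, one_add_accErr_one_mul, one_mul]
    _ ≤ _ := mul_le_mul_of_nonneg_left h1 (by linarith [accErr_nonneg 1])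

lemma abs_sub_le {x y : ℝ} (h : IsRounding x y) : |y - x| ≤ accErr 1 * |y| := by
  have h1 := h.abs_exact_le
  have h2 : unitRoundoff * (1 + accErr 1) = accErr 1 := by linarith [one_add_accErr_one_mul]
  calc |y - x| ≤ unitRoundoff * |x| := h
    _ ≤ unitRoundoff * ((1 + accErr 1) * |y|) :=
        mul_le_mul_of_nonneg_left h1 unitRoundoff_pos.le
    _ = _ := by rw [← mul_assoc, h2]

lemma abs_sub_le' {x y : ℝ} (h : IsRounding x y) : |y - x| ≤ accErr 1 * |x| :=
  le_trans h (mul_le_mul_of_nonneg_right unitRoundoff_le_accErr_one (abs_nonneg _))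

lemma abs_le {x y : ℝ} (h : IsRounding x y) : |y| ≤ (1 + accErr 1) * |x| := by
  have := abs_sub_abs_le_abs_sub y x
  have := h.abs_sub_le'
  linarith

end IsRounding

/-! ### Sums in arbitrary order: forward and backward errors -/

namespace IsFlSum

lemma card_pos {s : Multiset ℝ} {a : ℝ} (h : IsFlSum s a) : 0 < s.card := by
  induction h with
  | single x => simp
  | add _ _ _ ih _ => rw [Multiset.card_add]; omega

lemma abs_sum_le (s : Multiset ℝ) : |s.sum| ≤ (s.map abs).sum := by
  induction s using Multiset.induction_on with
  | empty => simp
  | cons a s ih =>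
    simp only [Multiset.sum_cons, Multiset.map_cons]
    exact (abs_add_le _ _).trans (by gcongr)

/-- Forward error of a floating-point sum. -/
lemma forward {s : Multiset ℝ} {a : ℝ} (h : IsFlSum s a) :
    |s.sum - a| ≤ accErr (s.card - 1) * (s.map abs).sum := by
  induction h with
  | single x => simp [accErr]
  | @add s t a b c hs ht hc ihs iht =>
    obtain ⟨k, hk⟩ := Nat.exists_eq_add_of_lt hs.card_pos
    obtain ⟨l, hl⟩ := Nat.exists_eq_add_of_lt ht.card_pos
    simp only [zero_add] at hk hl
    rw [hk, Nat.add_sub_cancel] at ihs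
    rw [hl, Nat.add_sub_cancel] at iht
    rw [Multiset.card_add, hk, hl, Multiset.sum_add, Multiset.map_add, Multiset.sum_add,
      show k + 1 + (l + 1) - 1 = k + l + 1 by omega]
    have hS := abs_sum_le s
    have hT := abs_sum_le t
    have hS0 := (abs_nonneg _).trans hS
    have hT0 := (abs_nonneg _).trans hT
    set S := s.sum
    set T := t.sum
    set S' := (s.map abs).sum
    set T' := (t.map abs).sum
    have hc' := hc.abs_sub_le'
    have e1 := one_add_accErr_add (k + l) 1
    have g1 := accErr_mono (Nat.le_add_right k l)
    have g2 := accErr_mono (Nat.le_add_left l k)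
    have ha := accErr_nonneg 1
    have hkl := accErr_nonneg (k + l)
    have h1 : |S + T - (a + b)| ≤ accErr (k + l) * (S' + T') := by
      have : |S + T - (a + b)| ≤ |S - a| + |T - b| := by
        rw [show S + T - (a + b) = (S - a) + (T - b) by ring]; exact abs_add_le _ _
      nlinarith
    have h2 : |a + b| ≤ (1 + accErr (k + l)) * (S' + T') := by
      have := abs_sub_abs_le_abs_sub (a + b) (S + T)
      rw [abs_sub_comm] at this
      have := abs_add_le S T
      linarith
    have h3 : |S + T - c| ≤ |S + T - (a + b)| + |c - (a + b)| := by
      rw [abs_sub_comm c]; exact abs_sub_le _ _ _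
    have h4 := mul_le_mul_of_nonneg_left h2 ha
    have : accErr (k + l + 1) * (S' + T') = accErr (k + l) * (S' + T') +
        accErr 1 * ((1 + accErr (k + l)) * (S' + T')) := by
      rw [show accErr (k + l + 1) = (1 + accErr (k + l)) * (1 + accErr 1) - 1 by linarith]; ring
    linarith

/-- Induction step for `IsFlSum.backward`: the subtree containing c carries a backward bound, the
other one, with l + 1 leaves, a forward bound. The intermediate |a| must be replaced by the final
result d, through |a| ≤ |a + b| + |b|. -/
lemma backward_step {c S S' a b d T T' : ℝ} {k l : ℕ}
    (h1 : |c + S - a| ≤ accErr k * (|a| + S')) (h2 : |T - b| ≤ accErr l * T')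
    (hT : |T| ≤ T') (hS : 0 ≤ S') (hd : IsRounding (a + b) d) :
    |c + (S + T) - d| ≤ accErr (k + (l + 1)) * (|d| + (S' + T')) := by
  have hT0 := (abs_nonneg _).trans hT
  have e1 := one_add_accErr_add k (l + 1)
  have e2 := one_add_accErr_add l 1
  have d1 := hd.abs_exact_le
  have d2 := hd.abs_sub_le
  have hk := accErr_nonneg k
  have hl := accErr_nonneg l
  have hu := accErr_nonneg 1
  have hb : |b| ≤ (1 + accErr l) * T' := by
    have := abs_sub_abs_le_abs_sub b T
    rw [abs_sub_comm] at this
    linarith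
  have ha : |a| ≤ (1 + accErr 1) * |d| + (1 + accErr l) * T' := by
    have : |a| ≤ |a + b| + |b| := by simpa using abs_sub (a + b) b
    linarith
  have h3 : |c + (S + T) - d| ≤ |c + S - a| + |T - b| + |d - (a + b)| := by
    rw [abs_sub_comm d, show c + (S + T) - d = (c + S - a) + (T - b) + (a + b - d) by ring]
    exact abs_add_three _ _ _
  have h4 := mul_le_mul_of_nonneg_left ha hk
  have e3 : accErr (k + (l + 1)) = (1 + accErr k) * ((1 + accErr l) * (1 + accErr 1)) - 1 := by
    rw [← e2, ← e1]; ring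
  rw [e3]
  generalize accErr k = x at *
  generalize accErr l = y at *
  generalize accErr 1 = z at *
  have p1 : 0 ≤ x * y := by positivity
  have p2 : 0 ≤ (1 + x) * (1 + z) * y * |d| := by positivity
  have p3 : 0 ≤ ((1 + x) * (1 + y) * z) * T' := by positivity
  have p4 : 0 ≤ (1 + x) * (y + z + y * z) * S' := by positivity
  nlinarith

/-- Error of a floating-point sum relative to one distinguished summand `c`, in terms of the
result and the other summands only. -/
lemma backward {s : Multiset ℝ} {a : ℝ} (h : IsFlSum s a) :
    ∀ (c : ℝ) (p : Multiset ℝ), s = c ::ₘ p →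
      |c + p.sum - a| ≤ accErr p.card * (|a| + (p.map abs).sum) := by
  induction h with
  | single x =>
    intro c p h
    have := congrArg Multiset.card h
    simp only [Multiset.card_singleton, Multiset.card_cons] at this
    obtain rfl : p = 0 := Multiset.card_eq_zero.1 (by omega)
    have : x = c := by simpa using h
    simp [this, accErr]
  | @add s t a b d hs ht hd ihs iht =>
    intro c p h
    have hmem : c ∈ s + t := h ▸ Multiset.mem_cons_self c p
    rcases Multiset.mem_add.1 hmem with hc | hc
    · obtain ⟨s', rfl⟩ := Multiset.exists_cons_of_mem hc
      obtain rfl : s' + t = p := by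
        rw [Multiset.cons_add, Multiset.cons_inj_right] at h; exact h
      obtain ⟨l, hl⟩ := Nat.exists_eq_add_of_lt ht.card_pos
      have f := ht.forward
      have := backward_step (ihs c s' rfl) f (abs_sum_le t)
        ((abs_nonneg _).trans (abs_sum_le s')) hd
      rw [hl] at this
      simpa [hl] using this
    · obtain ⟨t', rfl⟩ := Multiset.exists_cons_of_mem hc
      obtain rfl : t' + s = p := by
        rw [add_comm, Multiset.cons_add, Multiset.cons_inj_right] at h; exact h
      obtain ⟨l, hl⟩ := Nat.exists_eq_add_of_lt hs.card_pos
      have f := hs.forward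
      rw [add_comm] at hd
      have := backward_step (iht c t' rfl) f (abs_sum_le s)
        ((abs_nonneg _).trans (abs_sum_le t')) hd
      rw [hl] at this
      simpa [hl] using this

end IsFlSum

/-! ### Inner products, matrix products and substitution steps -/

lemma abs_sum_rounded_sub_le {ι : Type*} {K : Finset ι} {x p : ι → ℝ}
    (h : ∀ l ∈ K, IsRounding (x l) (p l)) :
    |∑ l ∈ K, x l - ∑ l ∈ K, p l| ≤ accErr 1 * ∑ l ∈ K, |x l| := by
  rw [← Finset.sum_sub_distrib, Finset.mul_sum]
  refine (Finset.abs_sum_le_sum_abs _ _).trans (Finset.sum_le_sum fun l hl => ?_)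
  rw [abs_sub_comm]; exact (h l hl).abs_sub_le'

lemma sum_abs_rounded_le {ι : Type*} {K : Finset ι} {x p : ι → ℝ}
    (h : ∀ l ∈ K, IsRounding (x l) (p l)) :
    ∑ l ∈ K, |p l| ≤ (1 + accErr 1) * ∑ l ∈ K, |x l| := by
  rw [Finset.mul_sum]
  exact Finset.sum_le_sum fun l hl => (h l hl).abs_le

lemma IsFlMul.abs_sub_le {m k n : ℕ} {A : Matrix (Fin m) (Fin k) ℝ}
    {B : Matrix (Fin k) (Fin n) ℝ} {C : Matrix (Fin m) (Fin n) ℝ} (h : IsFlMul A B C)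
    (i : Fin m) (j : Fin n) :
    |C i j - (A * B) i j| ≤ accErr k * ∑ l, |A i l * B l j| := by
  obtain ⟨p, hp, hs⟩ := h i j
  have hpos := hs.card_pos
  have hf := hs.forward
  simp only [Multiset.card_map, Finset.card_val, Finset.card_univ, Fintype.card_fin,
    Multiset.map_map] at hpos hf
  change |∑ l, p l - C i j| ≤ accErr (k - 1) * ∑ l, |p l| at hf
  have h1 := abs_sum_rounded_sub_le (K := Finset.univ) fun l _ => hp l
  have h2 := sum_abs_rounded_le (K := Finset.univ) fun l _ => hp l
  have h3 := mul_le_mul_of_nonneg_left h2 (accErr_nonneg (k - 1))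
  have e := one_add_accErr_add (k - 1) 1
  rw [Nat.sub_add_cancel hpos] at e
  rw [Matrix.mul_apply, abs_sub_comm]
  refine (_root_.abs_sub_le _ (∑ l, p l) _).trans ?_
  rw [show accErr k = (1 + accErr (k - 1)) * (1 + accErr 1) - 1 by linarith]
  linarith

namespace IsFlSubDot

variable {n : ℕ} {c : ℝ} {K : Finset (Fin n)} {a b : Fin n → ℝ} {t : ℝ}

/-- The error is charged to the result t and to the products, never to c. After the division or
square root the bound therefore involves only the computed factors, as a backward error must. -/
lemma abs_sub_le (h : IsFlSubDot c K a b t) :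
    |c - ∑ l ∈ K, a l * b l - t| ≤
      accErr K.card * |t| + accErr (K.card + 1) * ∑ l ∈ K, |a l * b l| := by
  obtain ⟨p, hp, hs⟩ := h
  have hb := hs.backward _ _ rfl
  simp only [Multiset.card_map, Finset.card_val, Multiset.map_map] at hb
  change |c + ∑ l ∈ K, -p l - t| ≤ accErr K.card * (|t| + ∑ l ∈ K, |-p l|) at hb
  simp only [Finset.sum_neg_distrib, abs_neg] at hb
  have h1 := abs_sum_rounded_sub_le hp
  have h2 := sum_abs_rounded_le hp
  have h3 := mul_le_mul_of_nonneg_left h2 (accErr_nonneg K.card)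
  have e := one_add_accErr_add K.card 1
  rw [abs_sub_comm] at h1
  rw [show c - ∑ l ∈ K, a l * b l - t =
    (c + -∑ l ∈ K, p l - t) + (∑ l ∈ K, p l - ∑ l ∈ K, a l * b l) by ring]
  refine (abs_add_le _ _).trans ?_
  rw [show accErr (K.card + 1) = (1 + accErr K.card) * (1 + accErr 1) - 1 by linarith]
  linarith

lemma div_residual (h : IsFlSubDot c K a b t) {d r : ℝ} (hd : d ≠ 0) (hr : IsRounding (t / d) r) :
    |c - ∑ l ∈ K, a l * b l - r * d| ≤
      accErr (K.card + 1) * (|r * d| + ∑ l ∈ K, |a l * b l|) := by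
  have h1 := h.abs_sub_le
  have hd' : 0 < |d| := abs_pos.2 hd
  have h2 : |t| ≤ (1 + accErr 1) * |r * d| := by
    have := mul_le_mul_of_nonneg_right hr.abs_exact_le hd'.le
    rwa [← abs_mul, div_mul_cancel₀ _ hd, mul_assoc, ← abs_mul] at this
  have h3 : |t - r * d| ≤ accErr 1 * |r * d| := by
    have := mul_le_mul_of_nonneg_right hr.abs_sub_le hd'.le
    rwa [← abs_mul, sub_mul, div_mul_cancel₀ _ hd, mul_assoc, ← abs_mul, abs_sub_comm] at this
  have h4 := mul_le_mul_of_nonneg_left h2 (accErr_nonneg K.card)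
  have e := one_add_accErr_add K.card 1
  have e' : accErr (K.card + 1) * |r * d| =
      accErr K.card * ((1 + accErr 1) * |r * d|) + accErr 1 * |r * d| := by
    rw [show accErr (K.card + 1) = (1 + accErr K.card) * (1 + accErr 1) - 1 by linarith]; ring
  rw [show c - ∑ l ∈ K, a l * b l - r * d =
    (c - ∑ l ∈ K, a l * b l - t) + (t - r * d) by ring]
  refine (abs_add_le _ _).trans ?_
  rw [mul_add, e']
  linarith

lemma sqrt_residual (h : IsFlSubDot c K a b t) (ht : 0 < t) {r : ℝ} (hr : IsRounding (√t) r) :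
    |c - ∑ l ∈ K, a l * b l - r * r| ≤
      accErr (K.card + 2) * (|r * r| + ∑ l ∈ K, |a l * b l|) := by
  have h1 := h.abs_sub_le
  have e2 := one_add_accErr_add 1 1
  norm_num at e2
  have hst : √t * √t = t := Real.mul_self_sqrt ht.le
  have hu := accErr_nonneg 1
  have i1 := hr.abs_exact_le
  have i2 := hr.abs_le
  rw [abs_of_nonneg (Real.sqrt_nonneg t)] at i1 i2
  have hrr : |r * r| = |r| * |r| := abs_mul _ _
  have habs : r * r = |r| * |r| := (abs_mul_abs_self r).symm
  have h2 : t ≤ (1 + accErr 2) * |r * r| := by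
    have := mul_self_le_mul_self (Real.sqrt_nonneg t) i1
    rw [e2, hrr]; linarith
  have h3 : |t - r * r| ≤ accErr 2 * |r * r| := by
    have h5 : r * r ≤ (1 + accErr 2) * t := by
      have := mul_self_le_mul_self (abs_nonneg r) i2
      rw [e2, habs]; nlinarith
    have ha2 := accErr_nonneg 2
    rw [abs_le, hrr, ← habs]
    rw [hrr, ← habs] at h2
    constructor
    -- `h5` bounds r² - t relative to t. If the bound relative to r² failed, then t < r² and the
    -- former would be the stronger one.
    · by_contra hcon
      push Not at hcon
      have : accErr 2 * t < accErr 2 * (r * r) ∨ accErr 2 = 0 := by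
        rcases ha2.eq_or_lt with h0 | h0
        · exact Or.inr h0.symm
        · left; apply mul_lt_mul_of_pos_left _ h0; nlinarith [mul_self_nonneg r]
      rcases this with h0 | h0
      · linarith
      · rw [h0] at hcon h5; linarith
    · linarith
  have h4 := mul_le_mul_of_nonneg_left h2 (accErr_nonneg K.card)
  have e := one_add_accErr_add K.card 2
  have e' : accErr (K.card + 2) * |r * r| =
      accErr K.card * ((1 + accErr 2) * |r * r|) + accErr 2 * |r * r| := by
    rw [show accErr (K.card + 2) = (1 + accErr K.card) * (1 + accErr 2) - 1 by linarith]; ring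
  have h6 : accErr (K.card + 1) * ∑ l ∈ K, |a l * b l| ≤
      accErr (K.card + 2) * ∑ l ∈ K, |a l * b l| :=
    mul_le_mul_of_nonneg_right (accErr_mono (by omega))
      (Finset.sum_nonneg fun _ _ => abs_nonneg _)
  rw [abs_of_pos ht] at h1
  rw [show c - ∑ l ∈ K, a l * b l - r * r =
    (c - ∑ l ∈ K, a l * b l - t) + (t - r * r) by ring]
  refine (abs_add_le _ _).trans ?_
  rw [mul_add, e']
  linarith

/-- For t ≤ 0 the contribution t + `accErr K.card` · |t| is nonpositive and drops out. This is the
only information left at a breakdown. -/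
lemma le_of_nonpos (h : IsFlSubDot c K a a t) (ht : t ≤ 0) (hK : accErr K.card ≤ 1) :
    c ≤ (1 + accErr (K.card + 1)) * ∑ l ∈ K, a l ^ 2 := by
  have h1 := (_root_.abs_le.1 h.abs_sub_le).2
  have e : ∑ l ∈ K, |a l * a l| = ∑ l ∈ K, a l ^ 2 :=
    Finset.sum_congr rfl fun l _ => by rw [abs_mul_self, sq]
  have e' : ∑ l ∈ K, a l * a l = ∑ l ∈ K, a l ^ 2 :=
    Finset.sum_congr rfl fun l _ => by rw [sq]
  rw [e, e', abs_of_nonpos ht] at h1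
  nlinarith

end IsFlSubDot

open Matrix

/-! ### Frobenius, spectral and column norms; the least singular value -/

section Norms

variable {l m n : ℕ}

lemma normF_nonneg (A : Matrix (Fin m) (Fin n) ℝ) : 0 ≤ normF A :=
  @norm_nonneg _ Matrix.frobeniusNormedAddCommGroup.toSeminormedAddCommGroup.toSeminormedAddGroup A

lemma normF_sq (A : Matrix (Fin m) (Fin n) ℝ) : normF A ^ 2 = ∑ i, ∑ j, A i j ^ 2 := by
  have : normF A = √(∑ i, ∑ j, A i j ^ 2) := by
    rw [normF, Real.sqrt_eq_rpow]
    refine (Matrix.frobenius_norm_def A).trans ?_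
    simp
  rw [this, Real.sq_sqrt]
  exact Finset.sum_nonneg fun _ _ => Finset.sum_nonneg fun _ _ => sq_nonneg _

lemma normF_add_le (A B : Matrix (Fin m) (Fin n) ℝ) : normF (A + B) ≤ normF A + normF B :=
  @norm_add_le _ Matrix.frobeniusNormedAddCommGroup.toSeminormedAddCommGroup.toSeminormedAddGroup A B

lemma normF_neg (A : Matrix (Fin m) (Fin n) ℝ) : normF (-A) = normF A :=
  @norm_neg _ Matrix.frobeniusNormedAddCommGroup.toSeminormedAddCommGroup.toSeminormedAddGroup A

lemma normF_transpose (A : Matrix (Fin m) (Fin n) ℝ) : normF Aᵀ = normF A :=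
  Matrix.frobenius_norm_transpose A

lemma normF_le_of_sq_le {A : Matrix (Fin m) (Fin n) ℝ} {c : ℝ} (hc : 0 ≤ c)
    (h : ∑ i, ∑ j, A i j ^ 2 ≤ c ^ 2) : normF A ≤ c := by
  rw [← normF_sq] at h
  exact abs_le_of_sq_le_sq' h hc |>.2

lemma norm2_nonneg (A : Matrix (Fin m) (Fin n) ℝ) : 0 ≤ norm2 A :=
  @norm_nonneg _ Matrix.instL2OpNormedAddCommGroup.toSeminormedAddCommGroup.toSeminormedAddGroup A

lemma norm2_add_le (A B : Matrix (Fin m) (Fin n) ℝ) : norm2 (A + B) ≤ norm2 A + norm2 B :=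
  @norm_add_le _ Matrix.instL2OpNormedAddCommGroup.toSeminormedAddCommGroup.toSeminormedAddGroup A B

lemma norm2_transpose (A : Matrix (Fin m) (Fin n) ℝ) : norm2 Aᵀ = norm2 A := by
  have := Matrix.l2_opNorm_conjTranspose A
  rwa [Matrix.conjTranspose_eq_transpose_of_trivial] at this

lemma norm_toLp_sq (v : Fin n → ℝ) : ‖WithLp.toLp 2 v‖ ^ 2 = ∑ i, v i ^ 2 := by
  rw [EuclideanSpace.norm_sq_eq]; simp

lemma sum_mulVec_sq_le (A : Matrix (Fin m) (Fin n) ℝ) (v : Fin n → ℝ) :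
    ∑ i, (A *ᵥ v) i ^ 2 ≤ norm2 A ^ 2 * ∑ i, v i ^ 2 := by
  rw [← norm_toLp_sq, ← norm_toLp_sq, ← mul_pow]
  exact pow_le_pow_left₀ (norm_nonneg _) (Matrix.l2_opNorm_mulVec A (WithLp.toLp 2 v)) 2

lemma norm2_le_of_sum_mulVec_sq_le {A : Matrix (Fin m) (Fin n) ℝ} {c : ℝ} (hc : 0 ≤ c)
    (h : ∀ v : Fin n → ℝ, ∑ i, (A *ᵥ v) i ^ 2 ≤ c ^ 2 * ∑ i, v i ^ 2) : norm2 A ≤ c := by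
  refine ContinuousLinearMap.opNorm_le_bound _ hc fun x => ?_
  have := h x.ofLp
  rw [← norm_toLp_sq, ← norm_toLp_sq, ← mul_pow] at this
  exact abs_le_of_sq_le_sq' this (by positivity) |>.2

lemma sum_mulVec_sq_le_normF (A : Matrix (Fin m) (Fin n) ℝ) (v : Fin n → ℝ) :
    ∑ i, (A *ᵥ v) i ^ 2 ≤ normF A ^ 2 * ∑ i, v i ^ 2 := by
  rw [normF_sq, Finset.sum_mul]
  exact Finset.sum_le_sum fun i _ =>
    Finset.sum_mul_sq_le_sq_mul_sq Finset.univ (fun j => A i j) v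

lemma norm2_le_normF (A : Matrix (Fin m) (Fin n) ℝ) : norm2 A ≤ normF A :=
  norm2_le_of_sum_mulVec_sq_le (normF_nonneg A) (sum_mulVec_sq_le_normF A)

lemma normF_mul_le_norm2_mul (A : Matrix (Fin l) (Fin m) ℝ) (B : Matrix (Fin m) (Fin n) ℝ) :
    normF (A * B) ≤ norm2 A * normF B := by
  refine normF_le_of_sq_le (mul_nonneg (norm2_nonneg _) (normF_nonneg _)) ?_
  rw [mul_pow, normF_sq, Finset.sum_comm, Finset.sum_comm (f := fun i j => B i j ^ 2),
    Finset.mul_sum]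
  exact Finset.sum_le_sum fun j _ => sum_mulVec_sq_le A fun i => B i j

lemma normF_mul_le_mul_norm2 (A : Matrix (Fin l) (Fin m) ℝ) (B : Matrix (Fin m) (Fin n) ℝ) :
    normF (A * B) ≤ normF A * norm2 B := by
  rw [← normF_transpose (A * B), ← normF_transpose A, ← norm2_transpose B, Matrix.transpose_mul,
    mul_comm]
  exact normF_mul_le_norm2_mul _ _

lemma sum_col_sq_le (A : Matrix (Fin m) (Fin n) ℝ) (j : Fin n) :
    ∑ i, A i j ^ 2 ≤ norm2 A ^ 2 := by
  have := sum_mulVec_sq_le A (Pi.single j 1)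
  simpa [Pi.single_apply, Matrix.col_apply] using this

lemma normF_sq_le (A : Matrix (Fin m) (Fin n) ℝ) : normF A ^ 2 ≤ n * norm2 A ^ 2 := by
  rw [normF_sq, Finset.sum_comm]
  refine (Finset.sum_le_sum fun j _ => sum_col_sq_le A j).trans ?_
  simp

lemma normF_le_sqrt_mul (A : Matrix (Fin m) (Fin n) ℝ) : normF A ≤ √n * norm2 A := by
  refine abs_le_of_sq_le_sq' ?_ (mul_nonneg (Real.sqrt_nonneg _) (norm2_nonneg _)) |>.2
  rw [mul_pow, Real.sq_sqrt (Nat.cast_nonneg n)]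
  exact normF_sq_le A

lemma normF_sq_le_normG_sq (A : Matrix (Fin m) (Fin n) ℝ) : normF A ^ 2 ≤ normG A ^ 2 := by
  rw [normF_sq, Finset.sum_comm, normG, mul_pow, Real.sq_sqrt (Nat.cast_nonneg n)]
  have : ∀ j : Fin n, ∑ i, A i j ^ 2 ≤ (⨆ j : Fin n, ‖WithLp.toLp 2 (fun i => A i j)‖) ^ 2 := by
    intro j
    rw [← norm_toLp_sq]
    exact pow_le_pow_left₀ (norm_nonneg _)
      (le_ciSup (f := fun j : Fin n => ‖WithLp.toLp 2 (fun i => A i j)‖)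
        (Set.finite_range _).bddAbove j) 2
  refine (Finset.sum_le_sum fun j _ => this j).trans ?_
  simp

lemma normG_nonneg (A : Matrix (Fin m) (Fin n) ℝ) : 0 ≤ normG A :=
  mul_nonneg (Real.sqrt_nonneg _) (Real.iSup_nonneg fun _ => norm_nonneg _)

lemma normF_le_normG (A : Matrix (Fin m) (Fin n) ℝ) : normF A ≤ normG A :=
  abs_le_of_sq_le_sq' (normF_sq_le_normG_sq A) (normG_nonneg A) |>.2

lemma normG_le (A : Matrix (Fin m) (Fin n) ℝ) : normG A ≤ √n * norm2 A := by
  refine mul_le_mul_of_nonneg_left ?_ (Real.sqrt_nonneg _)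
  refine Real.iSup_le (fun j => ?_) (norm2_nonneg A)
  refine abs_le_of_sq_le_sq' ?_ (norm2_nonneg _) |>.2
  rw [norm_toLp_sq]
  exact sum_col_sq_le A j

/-- In an eigenbasis of the adjoint of A composed with A the right side is a sum of eigenvalues
times squared coordinates; the eigenvalues decrease, and the one with index n - 1 is the square of
`sigmaMin A`. -/
lemma sigmaMin_sq_mul_le (hn : 1 ≤ n) (A : Matrix (Fin m) (Fin n) ℝ) (v : Fin n → ℝ) :
    sigmaMin A ^ 2 * ∑ i, v i ^ 2 ≤ ∑ i, (A *ᵥ v) i ^ 2 := by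
  set T := Matrix.toEuclideanLin A with hT
  have hfr : Module.finrank ℝ (EuclideanSpace ℝ (Fin n)) = n := finrank_euclideanSpace_fin
  have hS := T.isSymmetric_adjoint_comp_self
  set b := hS.eigenvectorBasis hfr
  set x : EuclideanSpace ℝ (Fin n) := WithLp.toLp 2 v
  have h1 : ∑ i, (A *ᵥ v) i ^ 2 = inner ℝ x ((LinearMap.adjoint T ∘ₗ T) x) := by
    rw [LinearMap.comp_apply, LinearMap.adjoint_inner_right, real_inner_self_eq_norm_sq,
      ← norm_toLp_sq]
    rfl
  have h2 : ∑ i, v i ^ 2 = ∑ i, b.repr x i ^ 2 := by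
    rw [← norm_toLp_sq, ← norm_toLp_sq]
    exact congrArg (· ^ 2) (b.repr.norm_map x).symm
  rw [h1, h2, ← b.repr.inner_map_map, PiLp.inner_apply, Finset.mul_sum]
  refine Finset.sum_le_sum fun i _ => ?_
  rw [hS.eigenvectorBasis_apply_self_apply hfr x i]
  have h3 : sigmaMin A ^ 2 ≤ hS.eigenvalues hfr i := by
    rw [sigmaMin, T.sq_singularValues_of_lt hfr (by omega : n - 1 < n)]
    refine hS.eigenvalues_antitone hfr (Fin.mk_le_mk.2 (by omega) : i ≤ ⟨n - 1, _⟩)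
  have h4 : ∀ y z : ℝ, inner ℝ y z = y * z := fun y z => by simp [mul_comm]
  rw [h4]
  simp only [RCLike.ofReal_real_eq_id, id]
  have := mul_le_mul_of_nonneg_right h3 (sq_nonneg (b.repr x i))
  linarith

lemma sigmaMin_pos (hn : 1 ≤ n) {A : Matrix (Fin m) (Fin n) ℝ} (hA : A.rank = n) :
    0 < sigmaMin A := by
  rw [sigmaMin, LinearMap.singularValues_pos_iff_lt_finrank_range]
  rw [Matrix.rank_eq_finrank_range_toLin A (EuclideanSpace.basisFun (Fin m) ℝ).toBasis
    (EuclideanSpace.basisFun (Fin n) ℝ).toBasis, ← Matrix.toEuclideanLin_eq_toLin_orthonormal] at hA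
  omega

lemma sigmaMin_le_norm2 (hn : 1 ≤ n) (A : Matrix (Fin m) (Fin n) ℝ) : sigmaMin A ≤ norm2 A := by
  have h1 := sigmaMin_sq_mul_le hn A (Pi.single ⟨0, hn⟩ 1)
  have h2 := sum_mulVec_sq_le A (Pi.single ⟨0, hn⟩ 1)
  have h3 : ∑ i, (Pi.single ⟨0, hn⟩ 1 : Fin n → ℝ) i ^ 2 = 1 := by simp [Pi.single_apply]
  rw [h3, mul_one] at h1 h2
  exact abs_le_of_sq_le_sq' (h1.trans h2) (norm2_nonneg _) |>.2

/-- A right inverse of a square matrix that is bounded below. -/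
lemma norm2_inv_le {T S : Matrix (Fin n) (Fin n) ℝ} (hTS : T * S = 1) {τ : ℝ} (hτ : 0 < τ)
    (h : ∀ v, τ ^ 2 * ∑ i, v i ^ 2 ≤ ∑ i, (T *ᵥ v) i ^ 2) : norm2 S ≤ 1 / τ := by
  refine norm2_le_of_sum_mulVec_sq_le (by positivity) fun v => ?_
  have := h (S *ᵥ v)
  rw [Matrix.mulVec_mulVec, hTS, Matrix.one_mulVec] at this
  rw [div_pow, one_pow, one_div, ← div_eq_inv_mul, le_div_iff₀' (by positivity)]
  exact this

lemma sum_mulVec_sq (A : Matrix (Fin m) (Fin n) ℝ) (v : Fin n → ℝ) :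
    ∑ i, (A *ᵥ v) i ^ 2 = v ⬝ᵥ (Aᵀ * A) *ᵥ v := by
  rw [← Matrix.mulVec_mulVec, Matrix.dotProduct_mulVec, Matrix.vecMul_transpose]
  simp [dotProduct, sq]

lemma abs_dotProduct_mulVec_le (E : Matrix (Fin n) (Fin n) ℝ) (v : Fin n → ℝ) :
    |v ⬝ᵥ E *ᵥ v| ≤ normF E * ∑ i, v i ^ 2 := by
  have h1 := sum_mulVec_sq_le_normF E v
  have h2 : (v ⬝ᵥ E *ᵥ v) ^ 2 ≤ (∑ i, v i ^ 2) * ∑ i, (E *ᵥ v) i ^ 2 :=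
    Finset.sum_mul_sq_le_sq_mul_sq _ _ _
  have h0 : 0 ≤ ∑ i, v i ^ 2 := Finset.sum_nonneg fun _ _ => sq_nonneg _
  refine abs_le_of_sq_le_sq ?_ (mul_nonneg (normF_nonneg _) h0)
  nlinarith [mul_le_mul_of_nonneg_left h1 h0]

lemma norm2_sq_le_of_gram {A : Matrix (Fin m) (Fin n) ℝ} {c : ℝ} (hc : 0 ≤ c)
    (h : ∀ v, ∑ i, (A *ᵥ v) i ^ 2 ≤ c * ∑ i, v i ^ 2) : norm2 A ^ 2 ≤ c := by
  rw [← Real.sq_sqrt hc]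
  refine pow_le_pow_left₀ (norm2_nonneg _) (norm2_le_of_sum_mulVec_sq_le (Real.sqrt_nonneg _) ?_) 2
  rwa [Real.sq_sqrt hc]

end Norms

/-! ### From componentwise to normwise bounds -/

section Componentwise

variable {l m n : ℕ}

/-- The Euclidean norm of the `j`-th column. -/
def colNorm (A : Matrix (Fin m) (Fin n) ℝ) (j : Fin n) : ℝ := √(∑ i, A i j ^ 2)

lemma colNorm_nonneg (A : Matrix (Fin m) (Fin n) ℝ) (j : Fin n) : 0 ≤ colNorm A j :=
  Real.sqrt_nonneg _

lemma colNorm_sq (A : Matrix (Fin m) (Fin n) ℝ) (j : Fin n) :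
    colNorm A j ^ 2 = ∑ i, A i j ^ 2 :=
  Real.sq_sqrt (Finset.sum_nonneg fun _ _ => sq_nonneg _)

lemma sum_colNorm_sq (A : Matrix (Fin m) (Fin n) ℝ) : ∑ j, colNorm A j ^ 2 = normF A ^ 2 := by
  rw [normF_sq, Finset.sum_comm]
  exact Finset.sum_congr rfl fun j _ => colNorm_sq A j

lemma colNorm_sq_le (A : Matrix (Fin m) (Fin n) ℝ) (j : Fin n) :
    colNorm A j ^ 2 ≤ normF A ^ 2 := by
  rw [← sum_colNorm_sq]
  exact Finset.single_le_sum (f := fun j => colNorm A j ^ 2) (fun _ _ => sq_nonneg _)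
    (Finset.mem_univ j)

lemma sum_abs_mul_sq_le {ι : Type*} (K : Finset ι) (x y : ι → ℝ) :
    (∑ i ∈ K, |x i * y i|) ^ 2 ≤ (∑ i ∈ K, x i ^ 2) * ∑ i ∈ K, y i ^ 2 := by
  have := Finset.sum_mul_sq_le_sq_mul_sq K (fun i => |x i|) (fun i => |y i|)
  simpa only [sq_abs, ← abs_mul] using this

lemma sum_abs_mul_le_sqrt {ι : Type*} (K : Finset ι) (x y : ι → ℝ) :
    ∑ i ∈ K, |x i * y i| ≤ √(∑ i ∈ K, x i ^ 2) * √(∑ i ∈ K, y i ^ 2) := by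
  rw [← Real.sqrt_mul (Finset.sum_nonneg fun _ _ => sq_nonneg _)]
  exact Real.le_sqrt_of_sq_le (sum_abs_mul_sq_le K x y)

lemma normF_le_of_componentwise {A : Matrix (Fin l) (Fin m) ℝ} {B : Matrix (Fin m) (Fin n) ℝ}
    {D : Matrix (Fin l) (Fin n) ℝ} {c : ℝ} (hc : 0 ≤ c)
    (h : ∀ i j, |D i j| ≤ c * ∑ k, |A i k * B k j|) : normF D ≤ c * (normF A * normF B) := by
  refine normF_le_of_sq_le (mul_nonneg hc (mul_nonneg (normF_nonneg _) (normF_nonneg _))) ?_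
  rw [mul_pow, mul_pow, normF_sq A, ← sum_colNorm_sq B, Finset.sum_mul, Finset.mul_sum]
  refine Finset.sum_le_sum fun i _ => ?_
  rw [Finset.mul_sum, Finset.mul_sum]
  refine Finset.sum_le_sum fun j _ => ?_
  have h1 := sum_abs_mul_sq_le Finset.univ (fun k => A i k) (fun k => B k j)
  rw [← colNorm_sq] at h1
  have h2 := pow_le_pow_left₀ (abs_nonneg _) (h i j) 2
  rw [sq_abs, mul_pow] at h2
  exact h2.trans (mul_le_mul_of_nonneg_left h1 (sq_nonneg c))

lemma normF_le_of_colNorm {A : Matrix (Fin m) (Fin n) ℝ} {E : Matrix (Fin n) (Fin n) ℝ} {c : ℝ}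
    (hc : 0 ≤ c) (h : ∀ i j, |E i j| ≤ c * (colNorm A i * colNorm A j)) :
    normF E ≤ c * normF A ^ 2 := by
  refine normF_le_of_sq_le (mul_nonneg hc (sq_nonneg _)) ?_
  rw [mul_pow, sq (normF A ^ 2), ← sum_colNorm_sq A, Finset.sum_mul, Finset.mul_sum]
  refine Finset.sum_le_sum fun i _ => ?_
  rw [Finset.mul_sum, Finset.mul_sum]
  refine Finset.sum_le_sum fun j _ => ?_
  have h2 := pow_le_pow_left₀ (abs_nonneg _) (h i j) 2
  rwa [sq_abs, mul_pow, mul_pow] at h2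

lemma sum_sum_abs_mul {v a : Fin n → ℝ} :
    ∑ i, ∑ j, |v i| * |v j| * (a i * a j) = (∑ i, |v i| * a i) ^ 2 := by
  rw [sq, Finset.sum_mul]
  refine Finset.sum_congr rfl fun i _ => ?_
  rw [Finset.mul_sum]
  exact Finset.sum_congr rfl fun j _ => by ring

lemma IsFlMul.normF_sub_le {A : Matrix (Fin l) (Fin m) ℝ} {B : Matrix (Fin m) (Fin n) ℝ}
    {C : Matrix (Fin l) (Fin n) ℝ} (h : IsFlMul A B C) :
    normF (C - A * B) ≤ accErr m * (normF A * normF B) :=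
  normF_le_of_componentwise (accErr_nonneg m) h.abs_sub_le

lemma IsFlMul.gram_abs_sub_le {A : Matrix (Fin m) (Fin n) ℝ} {G : Matrix (Fin n) (Fin n) ℝ}
    (h : IsFlMul Aᵀ A G) (i j : Fin n) :
    |G i j - (Aᵀ * A) i j| ≤ accErr m * (colNorm A i * colNorm A j) :=
  (h.abs_sub_le i j).trans (mul_le_mul_of_nonneg_left
    (sum_abs_mul_le_sqrt Finset.univ (fun k => A k i) (fun k => A k j)) (accErr_nonneg m))

lemma gram_diag (A : Matrix (Fin m) (Fin n) ℝ) (j : Fin n) : (Aᵀ * A) j j = colNorm A j ^ 2 := by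
  rw [colNorm_sq, Matrix.mul_apply]
  exact Finset.sum_congr rfl fun i _ => by rw [Matrix.transpose_apply, sq]

lemma sum_eq_sum_Iio_add {f : Fin n → ℝ} {i : Fin n} (h : ∀ k, i < k → f k = 0) :
    ∑ k, f k = f i + ∑ k ∈ Finset.Iio i, f k := by
  have h1 : ∑ k ∈ Finset.Iic i, f k = ∑ k, f k := by
    refine Finset.sum_subset (Finset.subset_univ _) fun k _ hk => h k ?_
    simpa using hk
  rw [← h1, ← Finset.Iio_insert, Finset.sum_insert (by simp)]

end Componentwise

/-! ### Backward error and absence of breakdown for Cholesky -/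

section Cholesky

variable {m n : ℕ} {G R : Matrix (Fin n) (Fin n) ℝ} {s : Fin n → ℝ}

namespace IsFlCholesky

lemma diag_pos (h : IsFlCholesky G s R) {i : Fin n} (hs : 0 < s i) : 0 < R i i := by
  have h1 := h.diag i
  have h2 := Real.sqrt_pos.2 hs
  have h3 := unitRoundoff_lt
  unfold IsRounding at h1
  rw [abs_of_pos h2] at h1
  nlinarith [(abs_le.1 h1).1]

/-- Componentwise backward error of the Cholesky factorization, on the rows with positive pivot. -/
lemma residual (h : IsFlCholesky G s R) {i j : Fin n} (hij : i ≤ j) (hs : 0 < s i) :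
    |G i j - ∑ k, R k i * R k j| ≤ accErr (n + 1) * ∑ k, |R k i * R k j| := by
  have hz : ∀ k, i < k → R k i * R k j = 0 := fun k hk => by rw [h.lower k i hk, zero_mul]
  rw [sum_eq_sum_Iio_add hz, sum_eq_sum_Iio_add (f := fun k => |R k i * R k j|)
    fun k hk => by rw [hz k hk, abs_zero]]
  -- The rounding of the square root counts twice, since it is squared; at the last diagonal entry
  -- this gives n + 1.
  have hcard : (Finset.Iio i).card + 2 ≤ n + 1 := by
    rw [Fin.card_Iio]; have := i.isLt; omega
  have hnn : 0 ≤ |R i i * R i j| + ∑ k ∈ Finset.Iio i, |R k i * R k j| := by positivity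
  rw [sub_add_eq_sub_sub, sub_right_comm]
  rcases hij.eq_or_lt with rfl | hlt
  · refine ((h.pivot i).sqrt_residual hs (h.diag i)).trans ?_
    exact mul_le_mul_of_nonneg_right (accErr_mono hcard) hnn
  · obtain ⟨t, ht, hr⟩ := h.upper i j hlt
    have := ht.div_residual (h.diag_pos hs).ne' hr
    rw [mul_comm (R i j)] at this
    exact this.trans (mul_le_mul_of_nonneg_right (accErr_mono (by omega)) hnn)

end IsFlCholesky

variable {A : Matrix (Fin m) (Fin n) ℝ}

/-- On the diagonal the backward error is relative to the column norm itself, so (1 - `accErr (n +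
1)`)‖R_j‖² ≤ G_jj ≤ (1 + `accErr m`)‖A_j‖². Only the pivot j has to be positive, so the bound is
available inside the induction of `pivot_pos`. -/
lemma colNorm_factor_sq_le (hG : IsFlMul Aᵀ A G) (h : IsFlCholesky G s R)
    (hsmall : accErr m + accErr (n + 1) ≤ 1 / 100) {j : Fin n} (hs : 0 < s j) :
    colNorm R j ^ 2 ≤ 1.03 * colNorm A j ^ 2 := by
  have h1 := h.residual le_rfl hs
  have h2 := hG.gram_abs_sub_le j j
  have e1 : ∑ k, R k j * R k j = colNorm R j ^ 2 := by
    rw [colNorm_sq]; exact Finset.sum_congr rfl fun _ _ => (sq _).symm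
  have e2 : ∑ k, |R k j * R k j| = colNorm R j ^ 2 := by
    rw [colNorm_sq]; exact Finset.sum_congr rfl fun _ _ => by rw [abs_mul_self, sq]
  rw [e1, e2] at h1
  rw [gram_diag, ← sq] at h2
  have h1' := (abs_le.1 h1).1
  have h2' := (abs_le.1 h2).2
  have g0 := accErr_nonneg m
  have g1 := accErr_nonneg (n + 1)
  nlinarith [sq_nonneg (colNorm R j), sq_nonneg (colNorm A j)]

lemma gram_residual (hG : IsFlMul Aᵀ A G) (h : IsFlCholesky G s R) {i j : Fin n} (hij : i ≤ j)
    (hs : 0 < s i) :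
    |(Aᵀ * A) i j - ∑ k, R k i * R k j| ≤
      accErr m * (colNorm A i * colNorm A j) + accErr (n + 1) * ∑ k, |R k i * R k j| := by
  have h1 := h.residual hij hs
  have h2 := hG.gram_abs_sub_le i j
  rw [abs_sub_comm] at h2
  exact (abs_sub_le _ (G i j) _).trans (add_le_add h2 h1)

lemma gram_comm (B : Matrix (Fin m) (Fin n) ℝ) (i j : Fin n) : (Bᵀ * B) i j = (Bᵀ * B) j i := by
  simp only [Matrix.mul_apply, Matrix.transpose_apply]
  exact Finset.sum_congr rfl fun _ _ => mul_comm _ _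

lemma abs_gram_sub_gram_le (hG : IsFlMul Aᵀ A G) (h : IsFlCholesky G s R)
    (hsmall : accErr m + accErr (n + 1) ≤ 1 / 100) (hs : ∀ j, 0 < s j) (i j : Fin n) :
    |(Rᵀ * R - Aᵀ * A) i j| ≤
      1.03 * (accErr m + accErr (n + 1)) * (colNorm A i * colNorm A j) := by
  wlog hij : i ≤ j generalizing i j
  · have := this j i (le_of_not_ge hij)
    rw [Matrix.sub_apply, gram_comm R, gram_comm A, mul_comm (colNorm A i), ← Matrix.sub_apply]
    exact this
  have h1 := gram_residual hG h hij (hs i)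
  have e : (Rᵀ * R) i j = ∑ k, R k i * R k j := by simp [Matrix.mul_apply]
  rw [Matrix.sub_apply, e, abs_sub_comm]
  have h2 := sum_abs_mul_sq_le Finset.univ (fun k => R k i) (fun k => R k j)
  rw [← colNorm_sq, ← colNorm_sq] at h2
  have hi := colNorm_factor_sq_le hG h hsmall (hs i)
  have hj := colNorm_factor_sq_le hG h hsmall (hs j)
  have hN := mul_nonneg (colNorm_nonneg A i) (colNorm_nonneg A j)
  have h3 : ∑ k, |R k i * R k j| ≤ 1.03 * (colNorm A i * colNorm A j) := by
    refine (abs_le_of_sq_le_sq' ?_ (by positivity)).2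
    refine h2.trans ?_
    calc _ ≤ (1.03 * colNorm A i ^ 2) * (1.03 * colNorm A j ^ 2) :=
          mul_le_mul hi hj (sq_nonneg _) (by positivity)
      _ = _ := by ring
  have g0 := accErr_nonneg m
  have g1 := accErr_nonneg (n + 1)
  have h4 := mul_le_mul_of_nonneg_left h3 g1
  nlinarith [mul_nonneg g0 hN]

lemma normF_factor_sq_le (hG : IsFlMul Aᵀ A G) (h : IsFlCholesky G s R)
    (hsmall : accErr m + accErr (n + 1) ≤ 1 / 100) (hs : ∀ j, 0 < s j) :
    normF R ^ 2 ≤ 1.03 * normF A ^ 2 := by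
  rw [← sum_colNorm_sq, ← sum_colNorm_sq, Finset.mul_sum]
  exact Finset.sum_le_sum fun j _ => colNorm_factor_sq_le hG h hsmall (hs j)

/-- These are k homogeneous equations in k + 1 unknowns. They are completed to a square system by a
zero row at k and unit rows below, which force the remaining coordinates to vanish. -/
lemma exists_leading_kernel (R : Matrix (Fin n) (Fin n) ℝ) (k : Fin n) :
    ∃ v : Fin n → ℝ, v ≠ 0 ∧ (∀ i, k < i → v i = 0) ∧ ∀ l, l < k → ∑ i, R l i * v i = 0 := by
  let B : Matrix (Fin n) (Fin n) ℝ := fun l i =>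
    if l < k then R l i else if l = k then 0 else if l = i then 1 else 0
  have hdet : B.det = 0 := Matrix.det_eq_zero_of_row_eq_zero k fun i => by simp [B]
  obtain ⟨v, hv, hBv⟩ := Matrix.exists_mulVec_eq_zero_iff.2 hdet
  refine ⟨v, hv, fun i hi => ?_, fun l hl => ?_⟩
  · have := congrFun hBv i
    simpa [B, Matrix.mulVec, dotProduct, hi.not_gt, hi.ne'] using this
  · have := congrFun hBv l
    simpa [B, Matrix.mulVec, dotProduct, hl] using this

lemma sum_sum_gram (B : Matrix (Fin m) (Fin n) ℝ) (v : Fin n → ℝ) :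
    ∑ i, ∑ j, v i * v j * (Bᵀ * B) i j = ∑ i, (B *ᵥ v) i ^ 2 := by
  rw [sum_mulVec_sq]
  simp only [dotProduct, Matrix.mulVec, Finset.mul_sum]
  exact Finset.sum_congr rfl fun i _ => Finset.sum_congr rfl fun j _ => by ring

/-- Final contradiction in `pivot_pos`, with φ = ‖A‖_F², V = ‖v‖², x = v_k, q = ‖A_k‖² and ρ the
squared norm of the computed part of column k of R. No upper bound for ρ is available, but ρx² has
coefficient 1 on the left of `hmain` and at most 2h on the right, so a large ρ only helps. What
remains is τV ≤ (2g + 5.06h)φV, which explains the factor 6. -/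
lemma breakdown_arith {g h τ φ V ρ q x S₁ S₂ : ℝ} (hg : 0 ≤ g) (hh : 0 ≤ h)
    (hsmall : g + h ≤ 1 / 100) (hτ : 6 * (g + h) * φ < τ) (hV : 0 < V) (hx : x ^ 2 ≤ V)
    (hq : 0 ≤ q) (hqφ : q ≤ φ) (hρq : (1 - g) * q ≤ (1 + h) * ρ) (hρ : 0 ≤ ρ) (h1 : S₁ ≤ φ * V)
    (h2 : S₂ ≤ 2.06 * φ * V + 2 * ρ * x ^ 2)
    (hmain : τ * V + (ρ - q) * x ^ 2 ≤ g * S₁ + h * S₂) : False := by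
  have k1 := mul_le_mul_of_nonneg_left h1 hg
  have k2 := mul_le_mul_of_nonneg_left h2 hh
  have k3 : q - (1 - 2 * h) * ρ ≤ (3 * h + g) * q := by
    -- The factor is chosen so that (1 - 3h)(1 + h) ≤ 1 - 2h.
    have p1 : (1 - 3 * h) * ((1 - g) * q) ≤ (1 - 3 * h) * ((1 + h) * ρ) :=
      mul_le_mul_of_nonneg_left hρq (by linarith)
    nlinarith [mul_nonneg (mul_nonneg hh hg) hq, mul_nonneg (mul_nonneg hh hh) hρ]
  have k4 : (q - (1 - 2 * h) * ρ) * x ^ 2 ≤ (3 * h + g) * φ * V := by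
    have hc : 0 ≤ 3 * h + g := by linarith
    calc _ ≤ (3 * h + g) * q * x ^ 2 := mul_le_mul_of_nonneg_right k3 (sq_nonneg _)
      _ ≤ (3 * h + g) * φ * x ^ 2 :=
        mul_le_mul_of_nonneg_right (mul_le_mul_of_nonneg_left hqφ hc) (sq_nonneg _)
      _ ≤ _ := mul_le_mul_of_nonneg_left hx (mul_nonneg hc (hq.trans hqφ))
  have k5 := mul_lt_mul_of_pos_right hτ hV
  have k6 : 0 ≤ φ * V := mul_nonneg (hq.trans hqφ) hV.le
  nlinarith [mul_nonneg hg k6, mul_nonneg hh k6]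

/-- The factorization does not break down if `A` is bounded below well above the rounding level. -/
theorem pivot_pos (hG : IsFlMul Aᵀ A G) (h : IsFlCholesky G s R)
    (hsmall : accErr m + accErr (n + 1) ≤ 1 / 100) {τ : ℝ}
    (hlow : ∀ v, τ * ∑ i, v i ^ 2 ≤ ∑ i, (A *ᵥ v) i ^ 2)
    (hτ : 6 * (accErr m + accErr (n + 1)) * normF A ^ 2 < τ) (k : Fin n) : 0 < s k := by
  induction k using WellFoundedLT.induction with
  | ind k ih =>
  by_contra hk
  push Not at hk
  have g0 := accErr_nonneg m
  have g1 := accErr_nonneg (n + 1)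
  obtain ⟨v, hv, hvk, hRv⟩ := exists_leading_kernel R k
  -- Only the rows above k come from positive pivots. For a column i < k the truncation loses
  -- nothing, by triangularity.
  let M : Matrix (Fin n) (Fin n) ℝ := fun l i => if l < k then R l i else 0
  have hMsum : ∀ i j, i < k → ∑ l, R l i * R l j = (Mᵀ * M) i j ∧
      ∑ l, |R l i * R l j| ≤ colNorm M i * colNorm M j := by
    intro i j hik
    have hM : ∀ l, R l i * R l j = M l i * M l j := by
      intro l
      by_cases hl : l < k
      · simp [M, hl]
      · simp [M, hl, h.lower l i (hik.trans_le (not_lt.1 hl))]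
    refine ⟨by simp [Matrix.mul_apply, hM], ?_⟩
    simp only [hM]
    exact sum_abs_mul_le_sqrt Finset.univ (fun l => M l i) (fun l => M l j)
  have hMv : M *ᵥ v = 0 := by
    ext l
    by_cases hl : l < k
    · simpa [M, Matrix.mulVec, dotProduct, hl] using hRv l hl
    · simp [M, Matrix.mulVec, dotProduct, hl]
  have hMcol : ∀ i, i < k → colNorm M i ^ 2 ≤ 1.03 * colNorm A i ^ 2 := by
    intro i hik
    refine le_trans (le_of_eq ?_) (colNorm_factor_sq_le hG h hsmall (ih i hik))
    rw [← gram_diag, ← (hMsum i i hik).1, colNorm_sq]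
    exact Finset.sum_congr rfl fun _ _ => (sq _).symm
  set ρ := colNorm M k ^ 2 with hρ
  have hρ' : ρ = ∑ l ∈ Finset.Iio k, R l k ^ 2 := by
    rw [hρ, colNorm_sq, ← Finset.sum_subset (Finset.subset_univ (Finset.Iio k))]
    · exact Finset.sum_congr rfl fun l hl => by simp [M, Finset.mem_Iio.1 hl]
    · intro l _ hl
      simp only [Finset.mem_Iio] at hl
      simp [M, hl]
  have hpiv : G k k ≤ (1 + accErr (n + 1)) * ρ := by
    have hc : (Finset.Iio k).card + 1 ≤ n + 1 := by
      rw [Fin.card_Iio]; have := k.isLt; omega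
    have h1 := (h.pivot k).le_of_nonpos hk
      ((accErr_mono (by omega : (Finset.Iio k).card ≤ n + 1)).trans (by linarith))
    rw [← hρ'] at h1
    have := mul_le_mul_of_nonneg_right (accErr_mono hc) (sq_nonneg (colNorm M k))
    linarith
  have hGk := (abs_le.1 (hG.gram_abs_sub_le k k)).1
  rw [gram_diag, ← sq] at hGk
  -- entrywise comparison, with the corner entry of the Gram matrix replaced by `ρ`
  have hentry : ∀ i j, |v i| * |v j| *
      |(Aᵀ * A) i j + (if i = k ∧ j = k then ρ - colNorm A k ^ 2 else 0) - (Mᵀ * M) i j| ≤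
      |v i| * |v j| * (accErr m * (colNorm A i * colNorm A j) +
        accErr (n + 1) * (colNorm M i * colNorm M j)) := by
    intro i j
    wlog hij : i ≤ j generalizing i j
    · have := this j i (le_of_not_ge hij)
      rw [gram_comm A, gram_comm M, mul_comm |v i|, mul_comm (colNorm A i),
        mul_comm (colNorm M i)]
      simpa only [and_comm] using this
    rcases lt_or_ge k j with hj | hj
    · simp [hvk j hj]
    refine mul_le_mul_of_nonneg_left ?_ (by positivity)
    rcases hij.trans hj |>.eq_or_lt with rfl | hik
    · obtain rfl : j = i := le_antisymm hj hij
      have hn1 := colNorm_nonneg A j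
      have hn2 := colNorm_nonneg M j
      simp only [and_self, if_true, gram_diag]
      rw [show colNorm A j ^ 2 + (ρ - colNorm A j ^ 2) - colNorm M j ^ 2 = 0 by rw [hρ]; ring,
        abs_zero]
      positivity
    · rw [if_neg (fun hc => hik.ne hc.1), add_zero, ← (hMsum i j hik).1]
      exact (gram_residual hG h hij (ih i hik)).trans
        (add_le_add_right (mul_le_mul_of_nonneg_left (hMsum i j hik).2 g1) _)
  have hV : 0 < ∑ i, v i ^ 2 := by
    obtain ⟨i, hi⟩ := Function.ne_iff.1 hv
    exact Finset.sum_pos' (fun _ _ => sq_nonneg _) ⟨i, Finset.mem_univ i, sq_pos_of_ne_zero hi⟩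
  refine breakdown_arith (S₁ := (∑ i, |v i| * colNorm A i) ^ 2)
    (S₂ := (∑ i, |v i| * colNorm M i) ^ 2) g0 g1 hsmall hτ hV
    (Finset.single_le_sum (f := fun i => v i ^ 2) (fun _ _ => sq_nonneg _) (Finset.mem_univ k))
    (sq_nonneg (colNorm A k)) (colNorm_sq_le A k) (by linarith) (sq_nonneg (colNorm M k)) ?_ ?_ ?_
  · have := Finset.sum_mul_sq_le_sq_mul_sq Finset.univ (fun i => |v i|) (colNorm A)
    simp only [sq_abs] at this
    rwa [sum_colNorm_sq, mul_comm (∑ i, v i ^ 2)] at this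
  · rw [← Finset.sum_erase_add _ _ (Finset.mem_univ k)]
    -- Column k is split off, because the bound of the columns of M by those of A holds only before
    -- k.
    have h1 : (∑ i ∈ Finset.univ.erase k, |v i| * colNorm M i) ^ 2 ≤
        (∑ i, v i ^ 2) * (1.03 * normF A ^ 2) := by
      have ht : ∀ i ∈ Finset.univ.erase k,
          |v i| * colNorm M i ≤ |v i| * (√1.03 * colNorm A i) := by
        intro i hi
        rcases lt_or_gt_of_ne (Finset.ne_of_mem_erase hi) with hik | hik
        · refine mul_le_mul_of_nonneg_left ?_ (abs_nonneg _)
          refine (abs_le_of_sq_le_sq' ?_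
            (mul_nonneg (Real.sqrt_nonneg _) (colNorm_nonneg A i))).2
          rw [mul_pow, Real.sq_sqrt (by norm_num)]
          exact hMcol i hik
        · simp [hvk i hik]
      have ht' := (Finset.sum_le_sum ht).trans (Finset.sum_le_sum_of_subset_of_nonneg
        (Finset.erase_subset k Finset.univ) fun i _ _ =>
          mul_nonneg (abs_nonneg (v i)) (mul_nonneg (Real.sqrt_nonneg 1.03) (colNorm_nonneg A i)))
      refine (pow_le_pow_left₀ (Finset.sum_nonneg fun i _ =>
        mul_nonneg (abs_nonneg _) (colNorm_nonneg M i)) ht' 2).trans ?_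
      refine (Finset.sum_mul_sq_le_sq_mul_sq _ _ _).trans (le_of_eq ?_)
      simp only [sq_abs, mul_pow, Real.sq_sqrt (show (0 : ℝ) ≤ 1.03 by norm_num),
        ← Finset.mul_sum, sum_colNorm_sq]
    have h2 : (|v k| * colNorm M k) ^ 2 = ρ * v k ^ 2 := by rw [mul_pow, sq_abs, hρ]; ring
    nlinarith [sq_nonneg ((∑ i ∈ Finset.univ.erase k, |v i| * colNorm M i) - |v k| * colNorm M k)]
  · have hA := sum_sum_gram A v
    have hM := sum_sum_gram M v
    rw [hMv] at hM
    simp only [Pi.zero_apply, ne_eq, OfNat.ofNat_ne_zero, not_false_eq_true, zero_pow,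
      Finset.sum_const_zero] at hM
    have hcorner : ∑ i, ∑ j, v i * v j * (if i = k ∧ j = k then ρ - colNorm A k ^ 2 else 0) =
        (ρ - colNorm A k ^ 2) * v k ^ 2 := by
      rw [Finset.sum_eq_single k, Finset.sum_eq_single k]
      · simp; ring
      · intro j _ hj; simp [hj]
      · simp
      · intro i _ hi; simp [hi]
      · simp
    refine (add_le_add_left (hlow v) _).trans ?_
    rw [← sum_sum_abs_mul, ← sum_sum_abs_mul, Finset.mul_sum, Finset.mul_sum,
      ← Finset.sum_add_distrib]
    rw [← hA, ← sub_zero (_ + _), ← hM, ← hcorner, ← Finset.sum_add_distrib,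
      ← Finset.sum_sub_distrib]
    refine Finset.sum_le_sum fun i _ => ?_
    rw [Finset.mul_sum, Finset.mul_sum, ← Finset.sum_add_distrib, ← Finset.sum_add_distrib,
      ← Finset.sum_sub_distrib]
    refine Finset.sum_le_sum fun j _ => ?_
    rw [← mul_add, ← mul_sub]
    refine (le_abs_self _).trans ?_
    rw [abs_mul, abs_mul]
    exact (hentry i j).trans (le_of_eq (by ring))

end Cholesky

/-! ### One CholeskyQR step -/

lemma IsFlTriSolve.normF_sub_le {m n : ℕ} {A V : Matrix (Fin m) (Fin n) ℝ}
    {R : Matrix (Fin n) (Fin n) ℝ} (h : IsFlTriSolve A R V) (hlow : ∀ i j, j < i → R i j = 0)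
    (hd : ∀ j, R j j ≠ 0) : normF (V * R - A) ≤ accErr n * (normF V * normF R) := by
  refine normF_le_of_componentwise (accErr_nonneg n) fun i j => ?_
  obtain ⟨t, ht, hr⟩ := h i j
  have hz : ∀ k, j < k → V i k * R k j = 0 := fun k hk => by rw [hlow k j hk, mul_zero]
  rw [Matrix.sub_apply, Matrix.mul_apply, abs_sub_comm, sum_eq_sum_Iio_add hz,
    sum_eq_sum_Iio_add (f := fun k => |V i k * R k j|) fun k hk => by rw [hz k hk, abs_zero],
    sub_add_eq_sub_sub, sub_right_comm]
  refine (ht.div_residual (hd j) hr).trans ?_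
  refine mul_le_mul_of_nonneg_right (accErr_mono ?_) (by positivity)
  rw [Fin.card_Iio]; have := j.isLt; omega

variable {m n : ℕ}

lemma exists_inverse_of_upperTriangular {T : Matrix (Fin n) (Fin n) ℝ}
    (hlow : ∀ i j, j < i → T i j = 0) (hd : ∀ i, T i i ≠ 0) : ∃ S, T * S = 1 := by
  refine ⟨T⁻¹, Matrix.mul_nonsing_inv T ?_⟩
  rw [Matrix.det_of_isUpperTriangular (fun i j hij => hlow i j hij), isUnit_iff_ne_zero]
  exact Finset.prod_ne_zero_iff.2 fun i _ => hd i

/-- Since SᵀTᵀTS = 1, the defect of AS from orthonormality is exactly the Gram error TᵀT - AᵀA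
conjugated by S. -/
lemma gram_sub_one_eq {A V D : Matrix (Fin m) (Fin n) ℝ} {T S : Matrix (Fin n) (Fin n) ℝ}
    (hTS : T * S = 1) (hD : D = V * T - A) :
    V = A * S + D * S ∧ Vᵀ * V - 1 = -(Sᵀ * ((Tᵀ * T - Aᵀ * A) * S)) + (A * S)ᵀ * (D * S) +
      (D * S)ᵀ * (A * S) + (D * S)ᵀ * (D * S) := by
  have hV : V = A * S + D * S := by
    rw [← Matrix.add_mul, hD, add_sub_cancel, Matrix.mul_assoc, hTS, Matrix.mul_one]
  refine ⟨hV, ?_⟩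
  have h1 : Sᵀ * ((Tᵀ * T - Aᵀ * A) * S) = 1 - (A * S)ᵀ * (A * S) := by
    have : Sᵀ * (Tᵀ * T * S) = 1 := by
      rw [Matrix.mul_assoc, hTS, Matrix.mul_one, ← Matrix.transpose_mul, hTS,
        Matrix.transpose_one]
    rw [Matrix.sub_mul, Matrix.mul_sub, this, Matrix.transpose_mul]
    simp only [Matrix.mul_assoc]
  rw [h1]
  nth_rewrite 1 2 [hV]
  rw [Matrix.transpose_add, Matrix.add_mul, Matrix.mul_add, Matrix.mul_add]
  abel

/-- One floating-point CholeskyQR step applied to a sufficiently well-conditioned matrix. -/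
theorem IsFlCholeskyQR.step {A V : Matrix (Fin m) (Fin n) ℝ} {s : Fin n → ℝ}
    {T : Matrix (Fin n) (Fin n) ℝ} (h : IsFlCholeskyQR A s V T) {σ f c η q p : ℝ}
    (hε : (m : ℝ) * unitRoundoff + ((n : ℝ) + 1) * unitRoundoff ≤ 1 / 110)
    (hσ : 0 < σ) (hlow : ∀ v, σ ^ 2 * ∑ i, v i ^ 2 ≤ ∑ i, (A *ᵥ v) i ^ 2) (hf : normF A ≤ f)
    (hη : 1.05 * ((m : ℝ) * unitRoundoff + ((n : ℝ) + 1) * unitRoundoff) * f ^ 2 ≤ η * σ ^ 2)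
    (hη0 : 0 ≤ η) (hη1 : η ≤ 1 / 10) (hc0 : 0 < c) (hc : 1 ≤ c ^ 2 * (1 - η))
    (hq0 : 0 ≤ q) (hq1 : q < 1) (hq : 1.03 * ((n : ℝ) * unitRoundoff * √n) * f * c ≤ q * σ)
    (hp : c ≤ p * (1 - q)) :
    (∀ i, 0 < s i) ∧ normF T ≤ 1.015 * f ∧ norm2 T ^ 2 ≤ (1 + η) * norm2 A ^ 2 ∧
      normF (V * T - A) ≤ 1.01 * ((n : ℝ) * unitRoundoff) * (normF V * normF T) ∧
      norm2 V ≤ p ∧ normF (Vᵀ * V - 1) ≤ c ^ 2 * η + 2 * c * (q * p) + (q * p) ^ 2 := by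
  -- Roles of the parameters: η is the relative Gram error, c bounds (1 - η)^(-1/2), q bounds ‖DS‖_F
  -- / ‖V‖₂, and p bounds c / (1 - q). The constants 1.05 and 1.03 in the hypotheses cover 1.03 ·
  -- 1.01 and 1.01 · 1.015.
  obtain ⟨G, hG, hT, hV⟩ := h
  have hu := unitRoundoff_pos
  have hmu : 0 ≤ (m : ℝ) * unitRoundoff := by positivity
  have hnu : 0 ≤ (n : ℝ) * unitRoundoff := by positivity
  set ε := (m : ℝ) * unitRoundoff + ((n : ℝ) + 1) * unitRoundoff with hεdef
  have hε0 : 0 ≤ ε := by positivity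
  have hf0 : 0 ≤ f := (normF_nonneg A).trans hf
  have hfsq : normF A ^ 2 ≤ f ^ 2 := pow_le_pow_left₀ (normF_nonneg A) hf 2
  have hgm : accErr m ≤ 1.01 * ((m : ℝ) * unitRoundoff) := accErr_le (by linarith)
  have hgn : accErr n ≤ 1.01 * ((n : ℝ) * unitRoundoff) := accErr_le (by linarith)
  have hgn1 : accErr (n + 1) ≤ 1.01 * (((n : ℝ) + 1) * unitRoundoff) := by
    have := accErr_le (k := n + 1) (by push_cast; linarith)
    push_cast at this; exact this
  have hg0 := accErr_nonneg m
  have hg1 := accErr_nonneg (n + 1)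
  have hsum : accErr m + accErr (n + 1) ≤ 1.01 * ε := by linarith
  have hsmall : accErr m + accErr (n + 1) ≤ 1 / 100 := by linarith
  have hσ2 : 0 < σ ^ 2 := by positivity
  -- With η ≤ 1/10 the breakdown threshold is at most 6 · (1.01 / 1.05) · σ² / 10 < σ².
  have hs : ∀ k, 0 < s k := by
    refine pivot_pos hG hT hsmall hlow ?_
    have h1 : (accErr m + accErr (n + 1)) * normF A ^ 2 ≤ (1.01 * ε) * f ^ 2 :=
      mul_le_mul hsum hfsq (sq_nonneg _) (by positivity)
    have h2 : η * σ ^ 2 ≤ 1 / 10 * σ ^ 2 := mul_le_mul_of_nonneg_right hη1 hσ2.le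
    linarith
  set E := Tᵀ * T - Aᵀ * A with hE
  have hEF : normF E ≤ η * σ ^ 2 := by
    have h1 := normF_le_of_colNorm (by positivity) (abs_gram_sub_gram_le hG hT hsmall hs)
    have h2 : 1.03 * (accErr m + accErr (n + 1)) * normF A ^ 2 ≤ (1.05 * ε) * f ^ 2 :=
      mul_le_mul (by linarith) hfsq (sq_nonneg _) (by positivity)
    linarith
  have hTF : normF T ≤ 1.015 * f := by
    refine (abs_le_of_sq_le_sq' ?_ (by positivity)).2
    have := normF_factor_sq_le hG hT hsmall hs
    rw [mul_pow]; linarith [sq_nonneg f]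
  -- The absolute bound on E becomes a relative one because ‖Av‖² ≥ σ²‖v‖².
  have hTA : ∀ v, |∑ i, (T *ᵥ v) i ^ 2 - ∑ i, (A *ᵥ v) i ^ 2| ≤ η * ∑ i, (A *ᵥ v) i ^ 2 := by
    intro v
    rw [sum_mulVec_sq T, sum_mulVec_sq A, ← dotProduct_sub, ← Matrix.sub_mulVec,
      ← sum_mulVec_sq A]
    refine (abs_dotProduct_mulVec_le E v).trans ?_
    have h0 : 0 ≤ ∑ i, v i ^ 2 := Finset.sum_nonneg fun _ _ => sq_nonneg _
    have h1 := mul_le_mul_of_nonneg_right hEF h0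
    have h2 := mul_le_mul_of_nonneg_left (hlow v) hη0
    linarith
  obtain ⟨S, hTS⟩ := exists_inverse_of_upperTriangular hT.lower fun i => (hT.diag_pos (hs i)).ne'
  have hS : norm2 S ≤ c / σ := by
    have := norm2_inv_le hTS (τ := σ / c) (by positivity) fun v => by
      have h1 := (abs_le.1 (hTA v)).1
      have h0 : 0 ≤ ∑ i, v i ^ 2 := Finset.sum_nonneg fun _ _ => sq_nonneg _
      have h2 := mul_le_mul_of_nonneg_left (hlow v) (by linarith : 0 ≤ 1 - η)
      have h3 : (σ / c) ^ 2 ≤ (1 - η) * σ ^ 2 := by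
        rw [div_pow, div_le_iff₀ (by positivity)]
        nlinarith
      have h4 := mul_le_mul_of_nonneg_right h3 h0
      linarith
    rwa [one_div_div] at this
  have hAS : norm2 (A * S) ≤ c := by
    refine norm2_le_of_sum_mulVec_sq_le hc0.le fun v => ?_
    have h1 := (abs_le.1 (hTA (S *ᵥ v))).1
    rw [Matrix.mulVec_mulVec, Matrix.mulVec_mulVec, hTS, Matrix.one_mulVec] at h1
    have h0 : 0 ≤ ∑ i, ((A * S) *ᵥ v) i ^ 2 := Finset.sum_nonneg fun _ _ => sq_nonneg _
    have h2 := mul_le_mul_of_nonneg_right hc h0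
    have h3 := mul_le_mul_of_nonneg_left h1 (sq_nonneg c)
    linarith
  set D := V * T - A with hD
  have hDF : normF D ≤ 1.01 * ((n : ℝ) * unitRoundoff) * (normF V * normF T) :=
    (hV.normF_sub_le hT.lower fun i => (hT.diag_pos (hs i)).ne').trans
      (mul_le_mul_of_nonneg_right hgn (mul_nonneg (normF_nonneg _) (normF_nonneg _)))
  have hV0 := norm2_nonneg V
  have hDS : normF (D * S) ≤ q * norm2 V := by
    have h1 : normF V * normF T ≤ (√n * norm2 V) * (1.015 * f) :=
      mul_le_mul (normF_le_sqrt_mul V) hTF (normF_nonneg _) (by positivity)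
    have h2 : normF D ≤ 1.01 * ((n : ℝ) * unitRoundoff) * ((√n * norm2 V) * (1.015 * f)) :=
      hDF.trans (mul_le_mul_of_nonneg_left h1 (by positivity))
    have h3 : normF (D * S) ≤
        1.01 * ((n : ℝ) * unitRoundoff) * ((√n * norm2 V) * (1.015 * f)) * (c / σ) :=
      (normF_mul_le_mul_norm2 D S).trans
        (mul_le_mul h2 hS (norm2_nonneg _) (by positivity))
    refine h3.trans ?_
    rw [mul_div_assoc', div_le_iff₀ hσ]
    have h4 := mul_le_mul_of_nonneg_right hq hV0
    have h5 : 0 ≤ ((n : ℝ) * unitRoundoff * √n) * f * c * norm2 V := by positivity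
    linarith
  obtain ⟨hVeq, hgram⟩ := gram_sub_one_eq hTS hD
  -- The bound on D involves V itself; ‖V‖₂ ≤ c + q‖V‖₂ is solved for ‖V‖₂.
  have hVp : norm2 V ≤ p := by
    have h1 : norm2 V ≤ norm2 (A * S) + norm2 (D * S) := by
      nth_rewrite 1 [hVeq]; exact norm2_add_le _ _
    have h2 := norm2_le_normF (D * S)
    have h3 : norm2 V * (1 - q) ≤ p * (1 - q) := by linarith
    exact le_of_mul_le_mul_right h3 (by linarith)
  have hDS' : normF (D * S) ≤ q * p := hDS.trans (mul_le_mul_of_nonneg_left hVp hq0)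
  refine ⟨hs, hTF, ?_, hDF, hVp, ?_⟩
  · refine norm2_sq_le_of_gram (by positivity) fun v => ?_
    have h1 := (abs_le.1 (hTA v)).2
    have h2 := mul_le_mul_of_nonneg_left (sum_mulVec_sq_le A v) (by linarith : 0 ≤ 1 + η)
    linarith
  · rw [hgram]
    have hF0 := normF_nonneg (D * S)
    have t1 : normF (-(Sᵀ * (E * S))) ≤ c ^ 2 * η := by
      rw [normF_neg]
      have h1 : normF (E * S) ≤ (η * σ ^ 2) * (c / σ) :=
        (normF_mul_le_mul_norm2 _ _).trans
          (mul_le_mul hEF hS (norm2_nonneg _) (by positivity))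
      have h2 := (normF_mul_le_norm2_mul Sᵀ (E * S)).trans
        (mul_le_mul (le_of_eq_of_le (norm2_transpose S) hS) h1 (normF_nonneg _) (by positivity))
      refine h2.trans (le_of_eq ?_)
      field_simp
    have t2 : normF ((A * S)ᵀ * (D * S)) ≤ c * (q * p) :=
      (normF_mul_le_norm2_mul _ _).trans
        (mul_le_mul (le_of_eq_of_le (norm2_transpose _) hAS) hDS' hF0 hc0.le)
    have t3 : normF ((D * S)ᵀ * (A * S)) ≤ (q * p) * c :=
      (normF_mul_le_mul_norm2 _ _).trans
        (mul_le_mul (le_of_eq_of_le (normF_transpose _) hDS') hAS (norm2_nonneg _)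
          (hF0.trans hDS'))
    have t4 : normF ((D * S)ᵀ * (D * S)) ≤ (q * p) * (q * p) :=
      (normF_mul_le_mul_norm2 _ _).trans
        (mul_le_mul (le_of_eq_of_le (normF_transpose _) hDS')
          ((norm2_le_normF _).trans hDS') (norm2_nonneg _) (hF0.trans hDS'))
    refine (normF_add_le _ _).trans ?_
    have a1 := normF_add_le (-(Sᵀ * (E * S)) + (A * S)ᵀ * (D * S)) ((D * S)ᵀ * (A * S))
    have a2 := normF_add_le (-(Sᵀ * (E * S))) ((A * S)ᵀ * (D * S))
    linarith

/-! ### The two steps combined -/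

lemma sum_mulVec_sq_ge_of_gram {W : Matrix (Fin m) (Fin n) ℝ} {δ : ℝ}
    (h : normF (Wᵀ * W - 1) ≤ δ) (v : Fin n → ℝ) :
    (1 - δ) * ∑ i, v i ^ 2 ≤ ∑ i, (W *ᵥ v) i ^ 2 := by
  have h1 := abs_dotProduct_mulVec_le (Wᵀ * W - 1) v
  have e : v ⬝ᵥ v = ∑ i, v i ^ 2 := by simp [dotProduct, sq]
  rw [Matrix.sub_mulVec, dotProduct_sub, ← sum_mulVec_sq, Matrix.one_mulVec, e] at h1
  have h0 : 0 ≤ ∑ i, v i ^ 2 := Finset.sum_nonneg fun _ _ => sq_nonneg _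
  have h2 := mul_le_mul_of_nonneg_right h h0
  linarith [(abs_le.1 h1).1]

/-- As j‖X‖₂ = ‖X‖_g, the spectral norm disappears from the condition, leaving the ratio f / σ
needed in the first step. -/
lemma sigmaMin_ge_of_cond2_le (hn : 1 ≤ n) {X : Matrix (Fin m) (Fin n) ℝ} (hrank : X.rank = n)
    (hcond : cond2 X ≤ boundK2 X) :
    10.5 * normG X * √((m : ℝ) * unitRoundoff + ((n : ℝ) + 1) * unitRoundoff) ≤ sigmaMin X := by
  have hu := unitRoundoff_pos
  have hσ := sigmaMin_pos hn hrank
  have hM : 0 < norm2 X := hσ.trans_le (sigmaMin_le_norm2 hn X)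
  have hg : 0 < normG X := hM.trans_le ((norm2_le_normF X).trans (normF_le_normG X))
  set e := √((m : ℝ) * unitRoundoff + ((n : ℝ) + 1) * unitRoundoff)
  have he : 0 < e := Real.sqrt_pos.2 (by positivity)
  have hj : 0 < ratioJ X := div_pos hg hM
  have h1 : norm2 X / sigmaMin X ≤ 1 / (10.5 * ratioJ X * e) := hcond
  rw [div_le_div_iff₀ hσ (by positivity), one_mul] at h1
  have h2 : norm2 X * ratioJ X = normG X := mul_div_cancel₀ _ hM.ne'
  linear_combination h1 - 10.5 * e * h2

lemma flCholeskyQR2_residual_eq {l : ℕ} (X W Q : Matrix (Fin l) (Fin n) ℝ)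
    (Y Z R : Matrix (Fin n) (Fin n) ℝ) :
    Q * R - X = Q * (R - Z * Y) + (Q * Z - W) * Y + (W * Y - X) := by
  rw [Matrix.mul_sub, Matrix.sub_mul, Matrix.mul_assoc]; abel

/-- From j ≤ √n the left side is at most 3.86 n² u‖X‖₂; the factor √n ≥ 1 on the right is not
needed. -/
lemma boundU6_lt (hn : 1 ≤ n) {X : Matrix (Fin m) (Fin n) ℝ} (hX : 0 < norm2 X) :
    boundU6 X < 5 * (n : ℝ) ^ 2 * √(n : ℝ) * unitRoundoff * norm2 X := by
  have hr : 0 < √(n : ℝ) := Real.sqrt_pos.2 (by exact_mod_cast hn)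
  have hn0 : (0 : ℝ) < n := by exact_mod_cast hn
  have hj : ratioJ X ≤ √(n : ℝ) := (div_le_iff₀ hX).2 (normG_le X)
  have hu := unitRoundoff_pos
  have hrr : √(n : ℝ) * √(n : ℝ) = n := Real.mul_self_sqrt hn0.le
  unfold boundU6
  refine mul_lt_mul_of_pos_right (mul_lt_mul_of_pos_right ?_ hu) hX
  have h1 : (2.52 * ratioJ X + 1.34 * √(n : ℝ)) * (n * √(n : ℝ)) ≤
      (3.86 * √(n : ℝ)) * (n * √(n : ℝ)) :=
    mul_le_mul_of_nonneg_right (by linarith) (by positivity)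
  have h2 : (3.86 * √(n : ℝ)) * (n * √(n : ℝ)) = 3.86 * (n : ℝ) ^ 2 := by
    linear_combination 3.86 * (n : ℝ) * hrr
  have h3 : (1 : ℝ) ≤ √(n : ℝ) := Real.one_le_sqrt.2 (by exact_mod_cast hn)
  have h4 : 5 * (n : ℝ) ^ 2 * 1 ≤ 5 * (n : ℝ) ^ 2 * √(n : ℝ) :=
    mul_le_mul_of_nonneg_left h3 (by positivity)
  have h5 : 0 < (n : ℝ) ^ 2 := by positivity
  linarith

theorem IsFlCholeskyQR2.bounds (hn : 1 ≤ n) (hmn : n ≤ m) {X : Matrix (Fin m) (Fin n) ℝ}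
    (hrank : X.rank = n) (h31 : (m : ℝ) * (n : ℝ) * unitRoundoff ≤ 1 / 64)
    (h32 : (n : ℝ) * ((n : ℝ) + 1) * unitRoundoff ≤ 1 / 64) (hcond : cond2 X ≤ boundK2 X)
    {s₁ s₂ : Fin n → ℝ} {Q : Matrix (Fin m) (Fin n) ℝ} {R : Matrix (Fin n) (Fin n) ℝ}
    (h : IsFlCholeskyQR2 X s₁ s₂ Q R) :
    (∀ i, 0 < s₁ i) ∧ (∀ i, 0 < s₂ i) ∧
      normF (Qᵀ * Q - 1) ≤ 5.9 * ((m : ℝ) * (n : ℝ) * unitRoundoff +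
        (n : ℝ) * ((n : ℝ) + 1) * unitRoundoff) ∧
      normF (Q * R - X) ≤ boundU6 X := by
  obtain ⟨W, Y, Z, hXWY, hWQZ, hR⟩ := h
  have hu := unitRoundoff_pos
  have hσ := sigmaMin_pos hn hrank
  have hσM := sigmaMin_le_norm2 hn X
  have hM : 0 < norm2 X := hσ.trans_le hσM
  have hMg : norm2 X ≤ normG X := (norm2_le_normF X).trans (normF_le_normG X)
  have hg : 0 < normG X := hM.trans_le hMg
  have hcond' := sigmaMin_ge_of_cond2_le hn hrank hcond
  set ε := (m : ℝ) * unitRoundoff + ((n : ℝ) + 1) * unitRoundoff with hε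
  have hε0 : 0 < ε := by positivity
  set e := √ε
  have he : 0 < e := Real.sqrt_pos.2 hε0
  have hee : e ^ 2 = ε := Real.sq_sqrt hε0.le
  have hn1 : (1 : ℝ) ≤ n := by exact_mod_cast hn
  set r := √(n : ℝ)
  have hr : 0 < r := Real.sqrt_pos.2 (by linarith)
  have hrr : r ^ 2 = n := Real.sq_sqrt (by linarith)
  set x := (n : ℝ) * unitRoundoff with hx
  have hx0 : 0 < x := by positivity
  have hmu : 0 ≤ (m : ℝ) * unitRoundoff := by positivity
  have hnε : (n : ℝ) * ε = (m : ℝ) * (n : ℝ) * unitRoundoff +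
      (n : ℝ) * ((n : ℝ) + 1) * unitRoundoff := by rw [hε]; ring
  have hnx : (n : ℝ) * x ≤ 1 / 64 := by nlinarith
  -- The smallness of ε comes from the condition number bound, since σₙ ≤ ‖X‖₂ ≤ ‖X‖_g.
  have he1 : e ≤ 1 / 10.5 := by
    have h1 : 10.5 * e * normG X ≤ 1 * normG X := by linarith
    have := le_of_mul_le_mul_right h1 hg
    rw [le_div_iff₀ (by norm_num)]; linarith
  have hε1 : ε ≤ 1 / 110 := by
    rw [← hee]
    refine (pow_le_pow_left₀ he.le he1 2).trans (by norm_num)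
  have hσ2 : 110.25 * (ε * normG X ^ 2) ≤ sigmaMin X ^ 2 := by
    have := pow_le_pow_left₀ (by positivity) hcond' 2
    rw [← hee]
    linarith
  -- Here m ≥ n enters: ε ≥ 2x, so (xr)² = x · nx ≤ x / 64 ≤ ε / 128, and 0.0884 exceeds 1/√128.
  have hxr : x * r ≤ 0.0884 * e := by
    refine (abs_le_of_sq_le_sq' ?_ (by positivity)).2
    rw [mul_pow x r, mul_pow _ e, hrr, hee]
    have h1 : x ^ 2 * n ≤ x * (1 / 64) := by
      rw [show x ^ 2 * n = x * (n * x) by ring]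
      exact mul_le_mul_of_nonneg_left hnx hx0.le
    have h2 : x ≤ (m : ℝ) * unitRoundoff :=
      mul_le_mul_of_nonneg_right (by exact_mod_cast hmn) hu.le
    linarith
  -- The value of η is 1.05 / 10.5² rounded up; q is 1.03 · 0.0884 · c / 10.5 rounded up.
  obtain ⟨hs₁, hYF, hY2, hD₁, hW2, hWW⟩ := hXWY.step (σ := sigmaMin X) (f := normG X)
    (c := 1.0049) (η := 0.0096) (q := 0.0088) (p := 1.014) hε1 hσ (sigmaMin_sq_mul_le hn X)
    (normF_le_normG X) (by linarith [mul_nonneg hε0.le (sq_nonneg (normG X))]) (by norm_num)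
    (by norm_num) (by norm_num) (by norm_num) (by norm_num) (by norm_num)
    (by
      have h1 := mul_le_mul_of_nonneg_right hxr hg.le
      linarith [mul_nonneg he.le hg.le])
    (by norm_num)
  have hδ : normF (Wᵀ * W - 1) ≤ 0.028 := hWW.trans (by norm_num)
  have hWF : normF W ≤ 1.014 * r := by
    refine (normF_le_sqrt_mul W).trans ?_
    rw [mul_comm]; exact mul_le_mul_of_nonneg_right hW2 hr.le
  have hτ : (n : ℝ) * ε ≤ 1 / 32 := by rw [hnε]; linarith
  have hnε0 : 0 < (n : ℝ) * ε := by positivity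
  have hnx0 : 0 < (n : ℝ) * x := by positivity
  -- The value of σ satisfies 0.985² ≤ 1 - 0.028. Now η and q are kept proportional to nε and nx, so
  -- that the final orthogonality error is too.
  obtain ⟨hs₂, hZF, -, hD₂, hQ2, hQQ⟩ := hWQZ.step (σ := 0.985) (f := 1.014 * r)
    (c := 1.018) (η := 1.113 * (n * ε)) (q := 1.09 * (n * x)) (p := 1.036) hε1 (by norm_num)
    (fun v => by
      have h1 := sum_mulVec_sq_ge_of_gram hδ v
      have h0 : 0 ≤ ∑ i, v i ^ 2 := Finset.sum_nonneg fun _ _ => sq_nonneg _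
      linarith) hWF
    (by rw [mul_pow, hrr]; linarith) (by positivity) (by linarith) (by norm_num)
    (by linarith) (by positivity) (by linarith)
    (by
      have : (n : ℝ) * x = x * r * r := by rw [← hrr]; ring
      rw [this] at hnx0 ⊢
      linarith)
    (by linarith)
  refine ⟨hs₁, hs₂, ?_, ?_⟩
  · rw [← hnε]
    refine hQQ.trans ?_
    have h1 : 2 * (n * x) ≤ 2 * (n * ε) := by
      have : x ≤ ε := by rw [hε]; linarith
      have := mul_le_mul_of_nonneg_left this (by linarith : (0 : ℝ) ≤ n)
      linarith
    have h2 := mul_le_mul_of_nonneg_right hnx hnx0.le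
    linarith
  -- The term (QZ - W)Y needs ‖Y‖₂, which yields the √n‖X‖₂ part of the bound; the other two terms
  -- use ‖Y‖_F and yield the part with ‖X‖_g = j‖X‖₂.
  · have hVY : norm2 Y ≤ 1.005 * norm2 X := by
      refine (abs_le_of_sq_le_sq' ?_ (by positivity)).2
      rw [mul_pow]; linarith [sq_nonneg (norm2 X)]
    have hZF' : normF Z ≤ 1.0293 * r := by linarith
    have hQF : normF Q ≤ 1.036 * r := by
      refine (normF_le_sqrt_mul Q).trans ?_
      rw [mul_comm]; exact mul_le_mul_of_nonneg_right hQ2 hr.le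
    have b1 : normF (W * Y - X) ≤ 1.01 * x * ((1.014 * r) * (1.015 * normG X)) :=
      hD₁.trans (mul_le_mul_of_nonneg_left
        (mul_le_mul hWF hYF (normF_nonneg _) (by positivity)) (by positivity))
    have b2 : normF ((Q * Z - W) * Y) ≤
        1.01 * x * ((1.036 * r) * (1.0293 * r)) * (1.005 * norm2 X) :=
      (normF_mul_le_mul_norm2 _ _).trans (mul_le_mul (hD₂.trans (mul_le_mul_of_nonneg_left
        (mul_le_mul hQF hZF' (normF_nonneg _) (by positivity)) (by positivity))) hVY
        (norm2_nonneg _) (by positivity))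
    have hgn : accErr n ≤ 1.01 * x := accErr_le (by linarith)
    have b3 : normF (Q * (R - Z * Y)) ≤
        1.036 * (1.01 * x * ((1.0293 * r) * (1.015 * normG X))) :=
      (normF_mul_le_norm2_mul _ _).trans (mul_le_mul hQ2 (hR.normF_sub_le.trans
        (mul_le_mul hgn (mul_le_mul hZF' hYF (normF_nonneg _) (by positivity))
          (mul_nonneg (normF_nonneg _) (normF_nonneg _)) (by positivity)))
        (normF_nonneg _) (by norm_num))
    rw [flCholeskyQR2_residual_eq X W Q Y Z R]
    have a1 := normF_add_le (Q * (R - Z * Y) + (Q * Z - W) * Y) (W * Y - X)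
    have a2 := normF_add_le (Q * (R - Z * Y)) ((Q * Z - W) * Y)
    have hU : boundU6 X = 2.52 * (x * r * normG X) + 1.34 * (x * r ^ 2 * norm2 X) := by
      have : ratioJ X * norm2 X = normG X := div_mul_cancel₀ _ hM.ne'
      rw [boundU6, ← this]; ring
    rw [hU]
    have p1 : 0 < x * r * normG X := by positivity
    have p2 : 0 < x * r ^ 2 * norm2 X := by positivity
    linarith

end

end FlQR

theorem corollary4p2 {m n : ℕ} (hn : 1 ≤ n) (hmn : n ≤ m)
    (X : Matrix (Fin m) (Fin n) ℝ) (hrank : X.rank = n)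
    (h31 : (m : ℝ) * (n : ℝ) * FlQR.unitRoundoff ≤ 1 / 64)
    (h32 : (n : ℝ) * ((n : ℝ) + 1) * FlQR.unitRoundoff ≤ 1 / 64)
    (hcond : FlQR.cond2 X ≤ FlQR.boundK2 X) :
    (∀ (s₁ s₂ : Fin n → ℝ) (Q : Matrix (Fin m) (Fin n) ℝ) (R : Matrix (Fin n) (Fin n) ℝ),
      FlQR.IsFlCholeskyQR2 X s₁ s₂ Q R →
        (∀ i, 0 < s₁ i) ∧ (∀ i, 0 < s₂ i) ∧
        FlQR.normF (Q.transpose * Q - 1) ≤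
          5.9 * ((m : ℝ) * (n : ℝ) * FlQR.unitRoundoff +
            (n : ℝ) * ((n : ℝ) + 1) * FlQR.unitRoundoff) ∧
        FlQR.normF (Q * R - X) ≤ FlQR.boundU6 X) ∧
    FlQR.boundU6 X < 5 * (n : ℝ) ^ 2 * √(n : ℝ) * FlQR.unitRoundoff * FlQR.norm2 X := by
  have hX : 0 < FlQR.norm2 X := (FlQR.sigmaMin_pos hn hrank).trans_le (FlQR.sigmaMin_le_norm2 hn X)
  exact ⟨fun _ _ _ _ h => h.bounds hn hmn hrank h31 h32 hcond, FlQR.boundU6_lt hn hX⟩
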